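/- Identify functions on $\mathbb S^1=\mathbb R/2\pi\mathbb Z$ with $2\pi$-periodic functions on $\mathbb R$. Let $a,A\in W^{1,\infty}(\mathbb S^1,\mathbb R)$ (continuous representatives), put $\widetilde a=\frac1{2\pi}\int_0^{2\pi}a(s)\,ds$, and assume that $\widetilde A=\frac1{2\pi}\int_0^{2\pi}A(s)\,ds\in\mathbb Z$. Let $L_{A,a}$ be the operator $$L_{A,a}\varphi=\Big(-i\frac{d}{d\theta}+A\Big)^2\varphi+a\varphi=-\varphi''+\big(a+A^2-iA'\big)\varphi-2iA\varphi'$$ in $L^2(\mathbb S^1,\mathbb C)$ with domain $H^2(\mathbb S^1,\mathbb C)$. Then its eigenvalues are real and, each repeated according to its multiplicity, form a sequence $\mu_1\le\mu_2\le\cdots$ with $\mu_k\to+\infty$. Moreover there exist $k^*,\ell\in\mathbb N$ and real numbers $\lambda_j$ ($j\in\mathbb Z$, $|j|\ge\ell$) such that $$\{\mu_k:k>k^*\}=\{\lambda_j:j\in\mathbb Z,\ |j|\ge\ell\},$$ with multiplicities (that is, $\lambda_j=\mu_{\sigma(j)}$ for a bijection $\sigma$ of $\{j\in\mathbb Z:|j|\ge\ell\}$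 onto $\{k:k>k^*\}$), and $$\lambda_j=\widetilde a+j^2+O\big(\tfrac1{|j|}\big)\quad\text{as }|j|\to\infty.$$ Furthermore, for every $j\in\mathbb Z$ with $|j|\ge\ell$ there exist $\theta_j\in[0,2\pi]$ and an eigenfunction $\phi_j$ of $L_{A,a}$ with eigenvalue $\lambda_j$ and $\int_0^{2\pi}|\phi_j(\theta)|^2\,d\theta=1$ such that $$\phi_j(\theta)=\frac1{\sqrt\pi}\,e^{-i\int_0^\theta A(t)\,dt}\cos\big(j(\theta-\theta_j)\big)+R_j(\theta),\qquad \|R_j\|_{L^\infty(\mathbb S^1)}=O\big(\tfrac1{|j|}\big)\quad\text{as }|j|\to\infty.$$ -/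

import Mathlib

open MeasureTheory Set Filter Asymptotics
open scoped Real ENNReal

/-!
Functions on the circle `S¹ = ℝ / 2πℤ` are identified with `2π`-periodic functions on `ℝ`, and the
measure on `S¹` is arc length, i.e. Lebesgue measure on one period.
-/

namespace MagneticCircle

/-- Arc length on the circle: Lebesgue measure on the period `(0, 2π]`. -/
noncomputable abbrev arc : Measure ℝ := volume.restrict (Ioc 0 (2 * π))

/-- `f ∈ W^{1,p}(S¹)`, for the continuous representative `f`: in one dimension the Sobolev
functions are the absolutely continuous functions whose almost everywhere derivative (which then
is the weak derivative) lies in `L^p`. -/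
structure MemW1 {E : Type*} [NormedAddCommGroup E] [NormedSpace ℝ E] (p : ℝ≥0∞) (f : ℝ → E) :
    Prop where
  periodic : Function.Periodic f (2 * π)
  absCont : AbsolutelyContinuousOnInterval f 0 (2 * π)
  memLp_deriv : MemLp (deriv f) p arc

/-- `φ ∈ H²(S¹, ℂ)`, for the `C¹` representative `φ`: the derivative of `φ` is in `H¹(S¹, ℂ)`. -/
structure MemH2 (φ : ℝ → ℂ) : Prop where
  periodic : Function.Periodic φ (2 * π)
  contDiff : ContDiff ℝ 1 φ
  deriv_mem : MemW1 2 (deriv φ)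

/-- The magnetic Schrödinger operator `(-i d/dθ + A)² + a` on the circle, written out as
`φ ↦ -φ'' + (a + A² - i A') φ - 2 i A φ'`. Its domain is `H²(S¹, ℂ)`. -/
noncomputable def magneticOp (A a : ℝ → ℝ) (φ : ℝ → ℂ) (θ : ℝ) : ℂ :=
  -deriv (deriv φ) θ + ((a θ : ℂ) + (A θ : ℂ) ^ 2 - Complex.I * ((deriv A θ : ℝ) : ℂ)) * φ θ
    - 2 * Complex.I * (A θ : ℂ) * deriv φ θ

/-- The mean value `(2π)⁻¹ ∫₀^{2π} f`. -/
noncomputable def mean (f : ℝ → ℝ) : ℝ := (1 / (2 * π)) * ∫ s in (0 : ℝ)..(2 * π), f s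

theorem MemW1.ae_differentiableAt {p : ℝ≥0∞} {f : ℝ → ℂ} (hf : MemW1 p f) :
    ∀ᵐ θ ∂arc, DifferentiableAt ℝ f θ := by
  rw [ae_restrict_iff' measurableSet_Ioc]
  filter_upwards [hf.absCont.boundedVariationOn.ae_differentiableAt_of_mem_uIcc] with x hx hmem
  exact hx (by rw [uIcc_of_le (by positivity)]; exact Ioc_subset_Icc_self hmem)

theorem MemH2.differentiable {φ : ℝ → ℂ} (h : MemH2 φ) : Differentiable ℝ φ :=
  h.contDiff.differentiable (by norm_num)

theorem MemH2.deriv_add_eq {φ ψ : ℝ → ℂ} (h : MemH2 φ) (k : MemH2 ψ) :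
    deriv (φ + ψ) = deriv φ + deriv ψ := by
  funext θ
  exact deriv_add (h.differentiable θ) (k.differentiable θ)

theorem MemH2.deriv_smul_eq {φ : ℝ → ℂ} (h : MemH2 φ) (c : ℂ) :
    deriv (c • φ) = c • deriv φ := by
  funext θ
  exact deriv_const_smul c (h.differentiable θ)

theorem MemH2.deriv2_add {φ ψ : ℝ → ℂ} (h : MemH2 φ) (k : MemH2 ψ) :
    deriv (deriv (φ + ψ)) =ᵐ[arc] deriv (deriv φ) + deriv (deriv ψ) := by
  rw [h.deriv_add_eq k]
  filter_upwards [h.deriv_mem.ae_differentiableAt, k.deriv_mem.ae_differentiableAt] with θ h1 h2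
  exact deriv_add h1 h2

theorem MemH2.deriv2_smul {φ : ℝ → ℂ} (h : MemH2 φ) (c : ℂ) :
    deriv (deriv (c • φ)) =ᵐ[arc] c • deriv (deriv φ) := by
  rw [h.deriv_smul_eq c]
  filter_upwards [h.deriv_mem.ae_differentiableAt] with θ h1
  exact deriv_const_smul c h1

theorem MemH2.zero : MemH2 0 := by
  have hd : deriv (0 : ℝ → ℂ) = 0 := by funext θ; exact deriv_const θ (0 : ℂ)
  refine ⟨fun _ => rfl, contDiff_const, ?_⟩
  rw [hd]
  refine ⟨fun _ => rfl, ?_, ?_⟩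
  · exact ((contDiff_const (c := (0 : ℂ))).contDiffOn).absolutelyContinuousOnInterval
  · rw [hd]; exact MemLp.zero

theorem MemH2.add {φ ψ : ℝ → ℂ} (h : MemH2 φ) (k : MemH2 ψ) : MemH2 (φ + ψ) := by
  refine ⟨h.periodic.add k.periodic, h.contDiff.add k.contDiff, ?_, ?_, ?_⟩
  · rw [h.deriv_add_eq k]; exact h.deriv_mem.periodic.add k.deriv_mem.periodic
  · rw [h.deriv_add_eq k]; exact h.deriv_mem.absCont.add k.deriv_mem.absCont
  · exact (h.deriv_mem.memLp_deriv.add k.deriv_mem.memLp_deriv).ae_eq (h.deriv2_add k).symm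

theorem MemH2.smul {φ : ℝ → ℂ} (h : MemH2 φ) (c : ℂ) : MemH2 (c • φ) := by
  refine ⟨h.periodic.smul c, contDiff_const.smul h.contDiff, ?_, ?_, ?_⟩
  · rw [h.deriv_smul_eq c]; exact h.deriv_mem.periodic.smul c
  · rw [h.deriv_smul_eq c]; exact h.deriv_mem.absCont.const_smul c
  · exact (h.deriv_mem.memLp_deriv.const_smul c).ae_eq (h.deriv2_smul c).symm

/-- The eigenspace `{φ ∈ H²(S¹, ℂ) : (-i d/dθ + A)² φ + a φ = z φ almost everywhere}`. -/
noncomputable def eigenspace (A a : ℝ → ℝ) (z : ℂ) : Submodule ℂ (ℝ → ℂ) where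
  carrier := {φ | MemH2 φ ∧ ∀ᵐ θ ∂arc, magneticOp A a φ θ = z * φ θ}
  zero_mem' := by
    have hd : deriv (0 : ℝ → ℂ) = 0 := by funext θ; exact deriv_const θ (0 : ℂ)
    refine ⟨MemH2.zero, Eventually.of_forall fun θ => ?_⟩
    simp [magneticOp, hd]
  add_mem' := by
    rintro φ ψ ⟨h, h1⟩ ⟨k, k1⟩
    refine ⟨h.add k, ?_⟩
    filter_upwards [h1, k1, h.deriv2_add k] with θ e1 e2 e3
    have e4 := congrFun (h.deriv_add_eq k) θ
    simp only [magneticOp, Pi.add_apply] at *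
    rw [e3, e4]
    linear_combination e1 + e2
  smul_mem' := by
    rintro c φ ⟨h, h1⟩
    refine ⟨h.smul c, ?_⟩
    filter_upwards [h1, h.deriv2_smul c] with θ e1 e3
    have e4 := congrFun (h.deriv_smul_eq c) θ
    simp only [magneticOp, Pi.smul_apply, smul_eq_mul] at *
    rw [e3, e4]
    linear_combination c * e1

/-- `μ 0 ≤ μ 1 ≤ μ 2 ≤ ⋯` is the list of all eigenvalues of the operator, each of them repeated
according to its multiplicity: every complex number `z` occurs in the list exactly
`dim (eigenspace A a z)` times; in particular there are no non-real eigenvalues. -/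
structure IsEigenvalueSeq (A a : ℝ → ℝ) (μ : ℕ → ℝ) : Prop where
  mono : Monotone μ
  mult : ∀ z : ℂ,
    {k : ℕ | (μ k : ℂ) = z}.encard = Cardinal.toENat (Module.rank ℂ (eigenspace A a z))

end MagneticCircle

/-!
The phase `exp (i ∫ A)` is `2π`-periodic because the mean of `A` is an integer, and multiplication
by it turns the magnetic operator into the Hill operator `-u'' + a u`. In the Fourier basis this is
the diagonal operator `n²` plus a bounded self-adjoint operator `V`, so its resolvent is compact
and, by the minimax principle, its `k`-th eigenvalue differs from the `k`-th term of the sorted list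
`0, 1, 1, 4, 4, …` by at most `‖V‖`.

If `-u'' + a u = (j² + δ) u` with `δ` bounded and `u` real and normalized, variation of constants
shows that `u` is within `O(1/|j|)` of a wave `cos (j (θ - θ_j)) / √π`. Testing the equation against
this wave, which is annihilated by `d²/dθ² + j²`, shows that the wave is orthogonal to `(a - δ) u`;
since `∫ a(θ) cos (2 j (θ - θ_j)) dθ = O(1/|j|)`, this forces `δ` to be the mean of `a` up to
`O(1/|j|)`.
-/

namespace MagneticCircle

section Enumeration

variable {α κ : Type*} [LinearOrder α] [Infinite κ]

theorem exists_equiv_nat_monotone {f : κ → α} (hf : ∀ k, {j | f j ≤ f k}.Finite) :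
    ∃ e : ℕ ≃ κ, Monotone (f ∘ e) := by
  let lex : κ → α ×ₗ Cardinal := fun k => toLex (f k, embeddingToCardinal k)
  have hlex : Function.Injective lex := fun i j h =>
    embeddingToCardinal.injective (congrArg (fun p => (ofLex p).2) h)
  let : LinearOrder κ := LinearOrder.lift' lex hlex
  have hmono : Monotone f := fun i j hij => Prod.Lex.monotone_fst _ _ hij
  have hIic (k : κ) : (Iic k).Finite := (hf k).subset fun _ hj => hmono hj
  let : LocallyFiniteOrder κ :=
    LocallyFiniteOrder.ofFiniteIcc fun i j => (hIic j).subset Icc_subset_Iic_self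
  obtain ⟨k₀⟩ : Nonempty κ := inferInstance
  obtain ⟨b, -, hb⟩ := exists_min_image (Iic k₀) id (hIic k₀) ⟨k₀, self_mem_Iic⟩
  let : OrderBot κ :=
    { bot := b
      bot_le := fun k => (le_total k k₀).elim (hb k) fun h => (hb k₀ self_mem_Iic).trans h }
  have : NoMaxOrder κ := ⟨fun k => by
    obtain ⟨j, hj⟩ := (hIic k).exists_notMem
    exact ⟨j, not_le.1 hj⟩⟩
  let := LinearLocallyFiniteOrder.succOrder κ
  let := LinearLocallyFiniteOrder.predOrder κ
  let e : κ ≃o ℕ := orderIsoNatOfLinearSuccPredArch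
  exact ⟨e.symm.toEquiv, hmono.comp e.symm.monotone⟩

end Enumeration

section DiagonalPerturbation

open scoped InnerProductSpace InnerProduct

variable {𝕜 E ι κ : Type*} [RCLike 𝕜] [NormedAddCommGroup E] [InnerProductSpace 𝕜 E]
  {b : HilbertBasis ι 𝕜 E} {d : ι → ℝ} {V : E →L[𝕜] E}

/-- The eigenspace for the eigenvalue `z` of `D + V`, where `D` is the unbounded operator that is
diagonal in the Hilbert basis `b` with the entries `d`. A solution `x` lies in the domain of `D`,
since `D x = z x - V x`. -/
def perturbedEigenspace (b : HilbertBasis ι 𝕜 E) (d : ι → ℝ) (V : E →L[𝕜] E) (z : 𝕜) :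
    Submodule 𝕜 E where
  carrier := {x | ∀ i, ⟪b i, V x⟫_𝕜 = (z - d i) * ⟪b i, x⟫_𝕜}
  zero_mem' i := by simp
  add_mem' hx hy i := by simp only [map_add, inner_add_right, hx i, hy i, mul_add]
  smul_mem' c x hx i := by simp only [map_smul, inner_smul_right, hx i, mul_left_comm]

theorem ext_inner_hilbertBasis (b : HilbertBasis ι 𝕜 E) {x y : E}
    (h : ∀ i, ⟪b i, x⟫_𝕜 = ⟪b i, y⟫_𝕜) : x = y :=
  b.repr.injective (lp.ext (funext fun i => by simpa only [b.repr_apply_apply] using h i))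

theorem smul_apply_of_mem_perturbedEigenspace {c : ℝ} {R : E →L[𝕜] E}
    (hR : ∀ x y, R y = x ↔ ∀ i, ⟪b i, y⟫_𝕜 = (d i + c) * ⟪b i, x⟫_𝕜 + ⟪b i, V x⟫_𝕜) {z : 𝕜}
    {x : E} (hx : x ∈ perturbedEigenspace b d V z) : (z + c) • R x = x := by
  rw [← map_smul, hR]
  intro i
  rw [hx i, inner_smul_right]
  ring

theorem eigenspace_le_perturbedEigenspace {c : ℝ} {R : E →L[𝕜] E}
    (hR : ∀ x y, R y = x ↔ ∀ i, ⟪b i, y⟫_𝕜 = (d i + c) * ⟪b i, x⟫_𝕜 + ⟪b i, V x⟫_𝕜) (τ : 𝕜) :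
    Module.End.eigenspace (R : Module.End 𝕜 E) τ ≤ perturbedEigenspace b d V (τ⁻¹ - c) := by
  intro x hx
  have hRx : R x = τ • x := Module.End.mem_eigenspace_iff.1 hx
  by_cases hτ : τ = 0
  · have hx0 : x = 0 := ext_inner_hilbertBasis b fun i => by
      simpa using (hR 0 x).1 (by rw [hRx, hτ, zero_smul]) i
    rw [hx0]
    exact zero_mem _
  · intro i
    have hi := (hR _ x).1 hRx i
    rw [map_smul, inner_smul_right, inner_smul_right] at hi
    field_simp
    linear_combination -hi

theorem norm_sq_sum_smul {e : κ → E} (he : Orthonormal 𝕜 e) (c : κ → 𝕜) (F : Finset κ) :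
    ‖∑ k ∈ F, c k • e k‖ ^ 2 = ∑ k ∈ F, ‖c k‖ ^ 2 := by
  simpa using he.orthogonalFamily.norm_sum c F

theorem norm_sum_smul_rankOne_le (b : HilbertBasis ι 𝕜 E) {g : ι → ℝ} {c : ℝ} {T : Finset ι}
    (hc : 0 ≤ c) (hg : ∀ i ∈ T, |g i| ≤ c) :
    ‖∑ i ∈ T, (g i : 𝕜) • InnerProductSpace.rankOne 𝕜 (b i) (b i)‖ ≤ c := by
  refine ContinuousLinearMap.opNorm_le_bound _ hc fun x => ?_
  refine (sq_le_sq₀ (norm_nonneg _) (by positivity)).1 ?_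
  have happly : (∑ i ∈ T, (g i : 𝕜) • InnerProductSpace.rankOne 𝕜 (b i) (b i)) x =
      ∑ i ∈ T, ((g i : 𝕜) * ⟪b i, x⟫_𝕜) • b i := by
    simp only [sum_apply, smul_apply, InnerProductSpace.rankOne_apply, smul_smul]
  rw [happly, norm_sq_sum_smul b.orthonormal]
  calc ∑ i ∈ T, ‖(g i : 𝕜) * ⟪b i, x⟫_𝕜‖ ^ 2
      ≤ ∑ i ∈ T, c ^ 2 * ‖⟪b i, x⟫_𝕜‖ ^ 2 := by
        refine Finset.sum_le_sum fun i hi => ?_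
        rw [norm_mul, mul_pow, RCLike.norm_ofReal]
        gcongr
        exact hg i hi
    _ ≤ c ^ 2 * ‖x‖ ^ 2 := by
        rw [← Finset.mul_sum]
        gcongr
        exact b.orthonormal.sum_inner_products_le x
    _ = (c * ‖x‖) ^ 2 := (mul_pow _ _ _).symm

theorem mul_norm_sq_le_re_inner (b : HilbertBasis ι 𝕜 E) {r : ℝ} {x y : E}
    (hxy : ∀ i, ⟪b i, y⟫_𝕜 = d i * ⟪b i, x⟫_𝕜) (hr : ∀ i, ⟪b i, x⟫_𝕜 = 0 ∨ r ≤ d i) :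
    r * ‖x‖ ^ 2 ≤ RCLike.re ⟪x, y⟫_𝕜 := by
  have hx := (b.hasSum_inner_mul_inner x x).mapL RCLike.reCLM
  have hy := (b.hasSum_inner_mul_inner x y).mapL RCLike.reCLM
  rw [← inner_self_eq_norm_sq (𝕜 := 𝕜)]
  refine hasSum_le (fun i => ?_) (hx.mul_left r) hy
  have hsq : ⟪x, b i⟫_𝕜 * ⟪b i, x⟫_𝕜 = ((‖⟪b i, x⟫_𝕜‖ ^ 2 : ℝ) : 𝕜) := by
    rw [← inner_conj_symm x, RCLike.conj_mul, RCLike.ofReal_pow]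
  have hdsq : ⟪x, b i⟫_𝕜 * (d i * ⟪b i, x⟫_𝕜) = ((d i * ‖⟪b i, x⟫_𝕜‖ ^ 2 : ℝ) : 𝕜) := by
    rw [mul_left_comm, hsq, RCLike.ofReal_mul]
  simp only [hxy, hsq, hdsq, RCLike.reCLM_apply, RCLike.ofReal_re]
  rcases hr i with hi | hi
  · simp [hi]
  · gcongr

theorem exists_sum_smul_inner_eq_zero (e : κ → E) (f : ι → E) {F : Finset κ} {S : Finset ι}
    (hlt : S.card < F.card) :
    ∃ c : F → 𝕜, c ≠ 0 ∧ ∀ i ∈ S, ⟪f i, ∑ k, c k • e k⟫_𝕜 = 0 := by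
  let L : (F → 𝕜) →ₗ[𝕜] S → 𝕜 := LinearMap.pi fun i =>
    (innerₛₗ 𝕜 (f i)).comp (Fintype.linearCombination 𝕜 fun k : F => e k)
  have hL : LinearMap.ker L ≠ ⊥ := LinearMap.ker_ne_bot_of_finrank_lt (by simpa using hlt)
  obtain ⟨c, hc, hc0⟩ := Submodule.exists_mem_ne_zero_of_ne_bot hL
  exact ⟨c, hc0, fun i hi => congrFun (LinearMap.mem_ker.1 hc) ⟨i, hi⟩⟩

/-- The minimax principle: on a suitable nonzero combination of the `e k`, `k ∈ F`, the form of
`D + V` is at most `Λ`, whereas that of `D` is at least `r`. -/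
theorem card_le_card_of_mem_perturbedEigenspace {e : κ → E} (he : Orthonormal 𝕜 e) {μ : κ → ℝ}
    (hμ : ∀ k, e k ∈ perturbedEigenspace b d V (μ k : 𝕜)) {F : Finset κ} {S : Finset ι} {Λ r : ℝ}
    (hF : ∀ k ∈ F, μ k ≤ Λ) (hS : ∀ i ∉ S, r ≤ d i) (hr : Λ + ‖V‖ < r) : F.card ≤ S.card := by
  by_contra! hlt
  obtain ⟨c, hc, hcS⟩ := exists_sum_smul_inner_eq_zero (𝕜 := 𝕜) e b hlt
  have heF : Orthonormal 𝕜 fun k : F => e k := he.comp _ Subtype.val_injective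
  set x : E := ∑ k : F, c k • e k with hx
  set y : E := ∑ k : F, (μ k * c k) • e k with hy
  have hx0 : x ≠ 0 := fun h => hc <| funext <|
    Fintype.linearIndependent_iff.1 heF.linearIndependent c h
  have hlower : r * ‖x‖ ^ 2 ≤ RCLike.re ⟪x, y - V x⟫_𝕜 := by
    refine mul_norm_sq_le_re_inner b (d := d) (fun i => ?_) fun i =>
      or_iff_not_imp_right.2 fun hi => hcS i (by_contra fun h => hi (hS i h))
    simp only [hx, hy, map_sum, map_smul, inner_sub_right, inner_sum, inner_smul_right, hμ _ i,
      Finset.mul_sum, ← Finset.sum_sub_distrib]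
    exact Finset.sum_congr rfl fun k _ => by ring
  have hupper : RCLike.re ⟪x, y⟫_𝕜 ≤ Λ * ‖x‖ ^ 2 := by
    rw [hx, hy, heF.inner_sum, norm_sq_sum_smul heF, map_sum, Finset.mul_sum]
    refine Finset.sum_le_sum fun k _ => ?_
    rw [mul_left_comm, RCLike.conj_mul, ← RCLike.ofReal_pow, ← RCLike.ofReal_mul, RCLike.ofReal_re]
    gcongr
    exact hF k k.2
  have hV : -(‖V‖ * ‖x‖ ^ 2) ≤ RCLike.re ⟪x, V x⟫_𝕜 := by
    refine (abs_le.1 ((RCLike.abs_re_le_norm _).trans ((norm_inner_le_norm _ _).trans ?_))).1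
    calc ‖x‖ * ‖V x‖ ≤ ‖x‖ * (‖V‖ * ‖x‖) := by gcongr; exact V.le_opNorm x
      _ = ‖V‖ * ‖x‖ ^ 2 := by ring
  rw [inner_sub_right, map_sub] at hlower
  have hpos : 0 < ‖x‖ ^ 2 := by positivity
  nlinarith

theorem finite_setOf_le_of_mem_perturbedEigenspace (hd : Tendsto d cofinite atTop)
    {e : κ → E} (he : Orthonormal 𝕜 e) {μ : κ → ℝ}
    (hμ : ∀ k, e k ∈ perturbedEigenspace b d V (μ k : 𝕜)) (Λ : ℝ) : {k | μ k ≤ Λ}.Finite := by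
  have hS : {i | ¬ Λ + ‖V‖ + 1 ≤ d i}.Finite := hd.eventually_ge_atTop _
  by_contra hinf
  obtain ⟨F, hF, hcard⟩ := Set.Infinite.exists_subset_card_eq hinf (hS.toFinset.card + 1)
  have hle := card_le_card_of_mem_perturbedEigenspace he hμ (F := F) (S := hS.toFinset)
    (fun k hk => hF hk) (fun i hi => by simpa using hi) (lt_add_one _)
  omega

theorem le_add_norm_of_monotone {e : κ → E} (he : Orthonormal 𝕜 e) {μ : κ → ℝ}
    (hμ : ∀ k, e k ∈ perturbedEigenspace b d V (μ k : 𝕜)) {σ : ℕ ≃ ι} (hσ : Monotone (d ∘ σ))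
    {τ : ℕ ≃ κ} (hτ : Monotone (μ ∘ τ)) (n : ℕ) : d (σ n) ≤ μ (τ n) + ‖V‖ := by
  by_contra! hlt
  have hle := card_le_card_of_mem_perturbedEigenspace he hμ
    (F := (Finset.range (n + 1)).map τ.toEmbedding) (S := (Finset.range n).map σ.toEmbedding)
    (Λ := μ (τ n)) (fun k hk => ?_) (fun i hi => ?_) hlt
  · simp at hle
  · obtain ⟨m, hm, rfl⟩ := Finset.mem_map.1 hk
    exact hτ (Finset.mem_range_succ_iff.1 hm)
  · obtain ⟨m, rfl⟩ := σ.surjective i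
    refine hσ (not_lt.1 fun hm => hi ?_)
    exact Finset.mem_map_of_mem σ.toEmbedding (Finset.mem_range.2 hm)

variable [CompleteSpace E]

theorem inner_eq_zero_of_mem_perturbedEigenspace (hV : IsSelfAdjoint V) {z w : 𝕜}
    (hzw : starRingEnd 𝕜 z ≠ w) {x y : E} (hx : x ∈ perturbedEigenspace b d V z)
    (hy : y ∈ perturbedEigenspace b d V w) : ⟪x, y⟫_𝕜 = 0 := by
  have hVx : HasSum (fun i => (starRingEnd 𝕜 z - d i) * (⟪x, b i⟫_𝕜 * ⟪b i, y⟫_𝕜)) ⟪V x, y⟫_𝕜 := by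
    refine (b.hasSum_inner_mul_inner (V x) y).congr_fun fun i => ?_
    rw [← inner_conj_symm (V x), hx i, map_mul, inner_conj_symm, map_sub, RCLike.conj_ofReal,
      mul_assoc]
  have hVy : HasSum (fun i => (w - d i) * (⟪x, b i⟫_𝕜 * ⟪b i, y⟫_𝕜)) ⟪x, V y⟫_𝕜 := by
    refine (b.hasSum_inner_mul_inner x (V y)).congr_fun fun i => ?_
    rw [hy i, mul_left_comm]
  have hdiff := hVx.sub hVy
  simp only [← sub_mul, sub_sub_sub_cancel_right] at hdiff
  have hxy := hdiff.unique ((b.hasSum_inner_mul_inner x y).mul_left _)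
  have hsymm : ⟪V x, y⟫_𝕜 = ⟪x, V y⟫_𝕜 := hV.isSymmetric x y
  rw [hsymm, sub_self, eq_comm] at hxy
  exact (mul_eq_zero.1 hxy).resolve_left (sub_ne_zero.2 hzw)

theorem perturbedEigenspace_eq_bot (hV : IsSelfAdjoint V) {z : 𝕜} (hz : starRingEnd 𝕜 z ≠ z) :
    perturbedEigenspace b d V z = ⊥ :=
  (Submodule.eq_bot_iff _).2 fun _ hx =>
    inner_self_eq_zero.1 (inner_eq_zero_of_mem_perturbedEigenspace hV hz hx hx)

theorem mem_perturbedEigenspace_neg (hV : IsSelfAdjoint V) {e : HilbertBasis κ 𝕜 E} {μ : κ → ℝ}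
    (he : ∀ k, e k ∈ perturbedEigenspace b d V (μ k : 𝕜)) (i : ι) :
    b i ∈ perturbedEigenspace e μ (-V) (d i : 𝕜) := fun k => by
  have hsymm : ⟪V (e k), b i⟫_𝕜 = ⟪e k, V (b i)⟫_𝕜 := hV.isSymmetric _ _
  rw [neg_apply, inner_neg_right, ← hsymm, ← inner_conj_symm, he k i, map_mul,
    inner_conj_symm, map_sub, RCLike.conj_ofReal, RCLike.conj_ofReal]
  ring

theorem exists_compact_diagonal (b : HilbertBasis ι 𝕜 E) {g : ι → ℝ} {c : ℝ}
    (hg : Tendsto g cofinite (nhds 0)) (hc : ∀ i, |g i| ≤ c) (hc0 : 0 ≤ c) :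
    ∃ G : E →L[𝕜] E, IsCompactOperator G ∧ IsSelfAdjoint G ∧ ‖G‖ ≤ c ∧
      ∀ i x, ⟪b i, G x⟫_𝕜 = g i * ⟪b i, x⟫_𝕜 := by
  classical
  have hsummable : Summable fun i => (g i : 𝕜) • InnerProductSpace.rankOne 𝕜 (b i) (b i) := by
    refine summable_iff_vanishing_norm.2 fun ε hε => ?_
    have hfin : {i | ¬ |g i| < ε / 2}.Finite := by
      simpa using (Metric.tendsto_nhds.1 hg (ε / 2) (half_pos hε))
    refine ⟨hfin.toFinset, fun T hT => ?_⟩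
    refine (norm_sum_smul_rankOne_le b (half_pos hε).le fun i hi => ?_).trans_lt (half_lt_self hε)
    by_contra hi'
    exact Finset.disjoint_left.1 hT hi (hfin.mem_toFinset.2 fun h => hi' h.le)
  obtain ⟨G, hG⟩ := hsummable
  refine ⟨G, ?_, ?_, ?_, fun i x => ?_⟩
  · refine isCompactOperator_of_tendsto hG (Eventually.of_forall fun T => ?_)
    refine sum_mem (S := compactOperator (RingHom.id 𝕜) E E) fun i _ => Submodule.smul_mem _ _ ?_
    exact (isCompactOperator_of_locallyCompactSpace_dom (innerSL 𝕜 (b i))).clm_comp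
      (ContinuousLinearMap.toSpanSingleton 𝕜 (b i))
  · refine hG.star.unique (hG.congr_fun fun i => ?_)
    rw [star_smul, RCLike.star_def, RCLike.conj_ofReal,
      (InnerProductSpace.isPositive_rankOne_self (b i)).isSelfAdjoint.star_eq]
  · exact le_of_tendsto hG.norm (Eventually.of_forall fun T =>
      norm_sum_smul_rankOne_le b hc0 fun i _ => hc i)
  · refine ((hG.mapL (ContinuousLinearMap.apply 𝕜 E x)).mapL (innerSL 𝕜 (b i))).unique ?_
    refine (hasSum_ite_eq i ((g i : 𝕜) * ⟪b i, x⟫_𝕜)).congr_fun fun j => ?_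
    split_ifs with hij
    · simp [hij, b.orthonormal.norm_eq_one, mul_comm]
    · simp [b.orthonormal.inner_eq_zero (Ne.symm hij)]

theorem exists_compact_inverse_diagonal (b : HilbertBasis ι 𝕜 E) (hd : Tendsto d cofinite atTop)
    {ε : ℝ} (hε : 0 < ε) :
    ∃ (c : ℝ) (G : E →L[𝕜] E), IsCompactOperator G ∧ IsSelfAdjoint G ∧ ‖G‖ ≤ ε ∧
      ∀ x w, G w = x ↔ ∀ i, ⟪b i, w⟫_𝕜 = (d i + c) * ⟪b i, x⟫_𝕜 := by
  obtain ⟨m, hm⟩ : BddBelow (range d) :=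
    (isBoundedUnder_of_eventually_ge (hd.eventually_ge_atTop 0)).bddBelow_range_of_cofinite
  set c : ℝ := ε⁻¹ - m
  have hle (i : ι) : ε⁻¹ ≤ d i + c := by linarith [hm (mem_range_self i)]
  have hpos (i : ι) : 0 < d i + c := (inv_pos.2 hε).trans_le (hle i)
  obtain ⟨G, hGc, hGs, hGn, hG⟩ := exists_compact_diagonal b (g := fun i => (d i + c)⁻¹)
    (tendsto_inv_atTop_zero.comp (tendsto_atTop_add_const_right _ _ hd))
    (fun i => by rw [abs_inv, abs_of_pos (hpos i)]; exact inv_le_of_inv_le₀ hε (hle i)) hε.le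
  refine ⟨c, G, hGc, hGs, hGn, fun x w => ?_⟩
  have hne (i : ι) : (d i + c : 𝕜) ≠ 0 := mod_cast (hpos i).ne'
  constructor
  · rintro rfl i
    rw [hG, RCLike.ofReal_inv, RCLike.ofReal_add, mul_inv_cancel_left₀ (hne i)]
  · refine fun h => ext_inner_hilbertBasis b fun i => ?_
    rw [hG, h i, RCLike.ofReal_inv, RCLike.ofReal_add, inv_mul_cancel_left₀ (hne i)]

/-- For large `c` the operator `D + V + c` has a compact inverse, namely `G (1 + V G)⁻¹` for the
inverse `G` of `D + c`. -/
theorem exists_compact_resolvent (b : HilbertBasis ι 𝕜 E) (hd : Tendsto d cofinite atTop)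
    (hV : IsSelfAdjoint V) :
    ∃ (c : ℝ) (R : E →L[𝕜] E), IsCompactOperator R ∧ IsSelfAdjoint R ∧
      ∀ x y, R y = x ↔ ∀ i, ⟪b i, y⟫_𝕜 = (d i + c) * ⟪b i, x⟫_𝕜 + ⟪b i, V x⟫_𝕜 := by
  obtain ⟨c, G, hGc, hGs, hGn, hG⟩ := exists_compact_inverse_diagonal b hd
    (ε := (‖V‖ + 1)⁻¹) (by positivity)
  obtain ⟨u, hu⟩ : IsUnit (1 + V * G) := by
    rw [← sub_neg_eq_add]
    refine isUnit_one_sub_of_norm_lt_one ?_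
    rw [norm_neg]
    calc ‖V * G‖ ≤ ‖V‖ * (‖V‖ + 1)⁻¹ := (norm_mul_le _ _).trans (by gcongr)
      _ < 1 := by rw [← div_eq_mul_inv, div_lt_one (by positivity)]; linarith
  have huW (w : E) : u.val (u⁻¹.val w) = w := congrArg (· w) u.mul_inv
  have hWu (w : E) : u⁻¹.val (u.val w) = w := congrArg (· w) u.inv_mul
  have happly (w : E) : u.val w = w + V (G w) := by rw [hu]; rfl
  refine ⟨c, G * u⁻¹.val, hGc.comp_clm _, ?_, fun x y => ?_⟩
  · have hcomm : star u.val * G = G * u := by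
      rw [hu, star_add, star_one, star_mul, hGs.star_eq, hV.star_eq, add_mul, mul_add, one_mul,
        mul_one, mul_assoc]
    rw [IsSelfAdjoint, star_mul, hGs.star_eq, ← Units.coe_star, star_inv,
      Units.inv_mul_eq_iff_eq_mul, Units.coe_star, ← mul_assoc, hcomm, Units.mul_inv_cancel_right]
  · have hcoord : (∀ i, ⟪b i, y⟫_𝕜 = (d i + c) * ⟪b i, x⟫_𝕜 + ⟪b i, V x⟫_𝕜) ↔
        G (y - V x) = x := by
      simp only [hG, inner_sub_right, sub_eq_iff_eq_add]
    rw [hcoord]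
    change G (u⁻¹.val y) = x ↔ _
    constructor
    · intro h
      have hy := happly (u⁻¹.val y)
      rw [huW, h] at hy
      rwa [hy, add_sub_cancel_right]
    · intro h
      have hy := happly (y - V x)
      rw [h, sub_add_cancel] at hy
      rwa [← hy, hWu]

theorem finiteDimensional_perturbedEigenspace (hd : Tendsto d cofinite atTop)
    (hV : IsSelfAdjoint V) (z : 𝕜) : FiniteDimensional 𝕜 (perturbedEigenspace b d V z) := by
  obtain ⟨c, R, hRc, -, hR⟩ := exists_compact_resolvent b hd hV
  by_cases hz : z + c = 0
  · have hbot : perturbedEigenspace b d V z = ⊥ := (Submodule.eq_bot_iff _).2 fun x hx => by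
      rw [← smul_apply_of_mem_perturbedEigenspace hR hx, hz, zero_smul]
    rw [hbot]
    infer_instance
  · have := ContinuousLinearMap.finite_dimensional_eigenspace hRc _ (inv_ne_zero hz)
    refine Submodule.finiteDimensional_of_le
      (S₂ := Module.End.eigenspace (R : Module.End 𝕜 E) (z + c)⁻¹) fun x hx => ?_
    rw [Module.End.mem_eigenspace_iff]
    exact (eq_inv_smul_iff₀ hz).2 (smul_apply_of_mem_perturbedEigenspace hR hx)

theorem orthogonal_iSup_perturbedEigenspace (hd : Tendsto d cofinite atTop)
    (hV : IsSelfAdjoint V) : (⨆ l : ℝ, perturbedEigenspace b d V (l : 𝕜))ᗮ = ⊥ := by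
  obtain ⟨c, R, hRc, hRs, hR⟩ := exists_compact_resolvent b hd hV
  refine le_bot_iff.1 ?_
  rw [← ContinuousLinearMap.orthogonalComplement_iSup_eigenspaces_eq_bot hRc hRs.isSymmetric]
  refine Submodule.orthogonal_le (iSup_le fun τ => ?_)
  refine (eigenspace_le_perturbedEigenspace hR τ).trans ?_
  by_cases hτ : starRingEnd 𝕜 (τ⁻¹ - c) = τ⁻¹ - c
  · obtain ⟨l, hl⟩ := RCLike.conj_eq_iff_real.1 hτ
    rw [hl]
    exact le_iSup (fun l : ℝ => perturbedEigenspace b d V (l : 𝕜)) l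
  · rw [perturbedEigenspace_eq_bot hV hτ]
    exact bot_le

theorem exists_hilbertBasis (hd : Tendsto d cofinite atTop) (hV : IsSelfAdjoint V) {μ : κ → ℝ}
    (hμ : ∀ l : ℝ, {k | μ k = l}.encard = Module.finrank 𝕜 (perturbedEigenspace b d V (l : 𝕜))) :
    ∃ e : HilbertBasis κ 𝕜 E, ∀ k, e k ∈ perturbedEigenspace b d V (μ k : 𝕜) := by
  have hfin (l : ℝ) : Finite {k // μ k = l} := Set.finite_of_encard_eq_coe (hμ l)
  let (l : ℝ) : Fintype {k // μ k = l} := Fintype.ofFinite _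
  have hfiber (l : ℝ) :
      Nonempty (OrthonormalBasis {k // μ k = l} 𝕜 (perturbedEigenspace b d V (l : 𝕜))) := by
    have := finiteDimensional_perturbedEigenspace (b := b) hd hV (l : 𝕜)
    refine ⟨(stdOrthonormalBasis 𝕜 _).reindex (Finite.equivFinOfCardEq ?_).symm⟩
    exact_mod_cast (ENat.card_eq_coe_natCard {k // μ k = l}).symm.trans (hμ l)
  let B (l : ℝ) := (hfiber l).some
  have horth : OrthogonalFamily 𝕜 (fun l : ℝ => perturbedEigenspace b d V (l : 𝕜))
      fun l => (perturbedEigenspace b d V (l : 𝕜)).subtypeₗᵢ := fun l l' hl x y =>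
    inner_eq_zero_of_mem_perturbedEigenspace hV (by simpa using hl) x.2 y.2
  have he : Orthonormal 𝕜 fun k => (B (μ k) ⟨k, rfl⟩ : E) :=
    (horth.orthonormal_sigma_orthonormal fun l => (B l).orthonormal).comp
      (fun k => (⟨μ k, k, rfl⟩ : Σ l, {k // μ k = l})) fun k k' h =>
        congrArg (fun p : Σ l, {k // μ k = l} => (p.2 : κ)) h
  have hspan : (Submodule.span 𝕜 (range fun k => (B (μ k) ⟨k, rfl⟩ : E)))ᗮ = ⊥ := by
    refine le_bot_iff.1 ?_
    rw [← orthogonal_iSup_perturbedEigenspace (b := b) hd hV]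
    refine Submodule.orthogonal_le (iSup_le fun l x hx => ?_)
    rw [← Subtype.coe_mk x hx, ← (B l).sum_repr ⟨x, hx⟩]
    simp only [Submodule.coe_sum, Submodule.coe_smul]
    refine Submodule.sum_mem _ fun k _ => Submodule.smul_mem _ _ (Submodule.subset_span ?_)
    obtain ⟨k, rfl⟩ := k
    exact mem_range_self k
  refine ⟨HilbertBasis.mkOfOrthogonalEqBot he hspan, fun k => ?_⟩
  rw [HilbertBasis.coe_mkOfOrthogonalEqBot]
  exact (B (μ k) _).2

theorem abs_sub_le_norm_of_monotone (hd : Tendsto d cofinite atTop) (hV : IsSelfAdjoint V)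
    {μ : ℕ → ℝ} (hmono : Monotone μ)
    (hμ : ∀ l : ℝ, {k | μ k = l}.encard = Module.finrank 𝕜 (perturbedEigenspace b d V (l : 𝕜)))
    {σ : ℕ ≃ ι} (hσ : Monotone (d ∘ σ)) (n : ℕ) : |μ n - d (σ n)| ≤ ‖V‖ := by
  obtain ⟨e, he⟩ := exists_hilbertBasis hd hV hμ
  have hlower := le_add_norm_of_monotone e.orthonormal he hσ (τ := Equiv.refl ℕ) hmono n
  have hupper := le_add_norm_of_monotone b.orthonormal (mem_perturbedEigenspace_neg hV he)
    (σ := Equiv.refl ℕ) hmono hσ n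
  rw [norm_neg] at hupper
  simp only [Equiv.refl_apply] at hlower hupper
  exact abs_sub_le_iff.2 ⟨by linarith, by linarith⟩

theorem exists_monotone_eigenvalues [Infinite ι] (b : HilbertBasis ι 𝕜 E)
    (hd : Tendsto d cofinite atTop) (hV : IsSelfAdjoint V) :
    ∃ μ : ℕ → ℝ, Monotone μ ∧ Tendsto μ atTop atTop ∧ ∀ l : ℝ,
      {k | μ k = l}.encard = Module.finrank 𝕜 (perturbedEigenspace b d V (l : 𝕜)) := by
  let K := Σ l : ℝ, Fin (Module.finrank 𝕜 (perturbedEigenspace b d V (l : 𝕜)))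
  have hcard (l : ℝ) : {k : K | k.1 = l}.encard =
      Module.finrank 𝕜 (perturbedEigenspace b d V (l : 𝕜)) := by
    have hrange : {k : K | k.1 = l} = range (Sigma.mk l) := (range_sigmaMk l).symm
    rw [hrange, ← image_univ, sigma_mk_injective.encard_image, encard_univ,
      ENat.card_eq_coe_fintype_card, Fintype.card_fin]
  obtain ⟨e, he⟩ := exists_hilbertBasis hd hV hcard
  have hfinite := finite_setOf_le_of_mem_perturbedEigenspace hd e.orthonormal he
  have hK : Infinite K := by
    by_contra hK
    have := not_infinite_iff_finite.1 hK
    let := Fintype.ofFinite K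
    have := e.toOrthonormalBasis.toBasis.finiteDimensional_of_finite
    exact not_finite_iff_infinite.2 ‹_› b.orthonormal.linearIndependent.finite
  obtain ⟨τ, hτ⟩ := exists_equiv_nat_monotone fun k : K => hfinite k.1
  refine ⟨fun n => (τ n).1, hτ, ?_, fun l => ?_⟩
  · refine tendsto_atTop_atTop_of_monotone hτ fun Λ => ?_
    obtain ⟨k, hk⟩ := (hfinite Λ).exists_notMem
    exact ⟨τ.symm k, by simpa using (not_le.1 hk).le⟩
  · rw [← hcard l]
    exact encard_preimage_of_bijective (t := {k : K | k.1 = l}) τ.bijective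

end DiagonalPerturbation

section Periodic

theorem eq_of_periodic_of_eqOn {E : Type*} {f g : ℝ → E} {T : ℝ} (hT : 0 < T)
    (hf : Function.Periodic f T) (hg : Function.Periodic g T) (h : EqOn f g (Icc 0 T)) : f = g := by
  have hp : Function.Periodic (fun x => (f x, g x)) T := fun x => by simp only [hf x, hg x]
  funext x
  obtain ⟨y, hy, hxy⟩ := hp.exists_mem_Ico₀ hT x
  simp only [Prod.mk.injEq] at hxy
  rw [hxy.1, hxy.2, h (Ico_subset_Icc_self hy)]

theorem continuous_of_periodic_of_continuousOn {E : Type*} [TopologicalSpace E] {f : ℝ → E} {T : ℝ}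
    (hT : 0 < T) (hf : Function.Periodic f T) (h : ContinuousOn f (Icc 0 T)) : Continuous f := by
  have : Fact (0 < T) := ⟨hT⟩
  have hlift := (AddCircle.liftIco_continuous (p := T) (hf 0).symm (by simpa using h)).comp
    (AddCircle.continuous_mk' T)
  convert hlift using 1
  refine eq_of_periodic_of_eqOn hT hf (fun x => by simp) fun x hx => ?_
  rcases hx.2.eq_or_lt with rfl | hlt
  · have h0 := AddCircle.liftIco_coe_apply (f := f) (show (0 : ℝ) ∈ Ico 0 (0 + x) by simp [hT])
    have hx0 : ((x : ℝ) : AddCircle x) = ((0 : ℝ) : AddCircle x) := by simp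
    rw [Function.comp_apply, QuotientAddGroup.mk'_apply, hx0, h0, ← hf 0, zero_add]
  · exact (AddCircle.liftIco_coe_apply (by simpa using ⟨hx.1, hlt⟩)).symm

theorem continuous_of_hasDerivAt {F : Type*} [NormedAddCommGroup F] [NormedSpace ℝ F]
    {u v : ℝ → F} (h : ∀ x, HasDerivAt u (v x) x) : Continuous u :=
  continuous_iff_continuousAt.2 fun x => (h x).continuousAt

theorem periodic_of_hasDerivAt {F : Type*} [NormedAddCommGroup F] [NormedSpace ℝ F] {u v : ℝ → F}
    {T : ℝ} (hu : Function.Periodic u T) (h : ∀ x, HasDerivAt u (v x) x) :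
    Function.Periodic v T := fun x => by
  have hshift := (h (x + T)).comp_add_const x T
  rw [funext hu] at hshift
  exact hshift.unique (h x)

theorem periodic_primitive {F : Type*} [NormedAddCommGroup F] [NormedSpace ℝ F] {f : ℝ → F} {T : ℝ}
    (hc : Continuous f) (hp : Function.Periodic f T) (h0 : ∫ t in (0 : ℝ)..T, f t = 0) :
    Function.Periodic (fun x => ∫ t in (0 : ℝ)..x, f t) T := fun x => by
  simpa [h0] using hp.intervalIntegral_add_eq_add 0 x fun _ _ => hc.intervalIntegrable _ _

end Periodic

section AbsolutelyContinuous

theorem MemW1.mono {E : Type*} [NormedAddCommGroup E] [NormedSpace ℝ E] {p q : ℝ≥0∞} {f : ℝ → E}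
    (hf : MemW1 q f) (hpq : p ≤ q) : MemW1 p f :=
  ⟨hf.periodic, hf.absCont, hf.memLp_deriv.mono_exponent hpq⟩

theorem MemW1.continuous {E : Type*} [NormedAddCommGroup E] [NormedSpace ℝ E] {p : ℝ≥0∞}
    {f : ℝ → E} (hf : MemW1 p f) : Continuous f :=
  continuous_of_periodic_of_continuousOn Real.two_pi_pos hf.periodic
    (by simpa only [uIcc_of_le Real.two_pi_pos.le] using hf.absCont.continuousOn)

theorem ae_arc_iff {p : ℝ → Prop} :
    (∀ᵐ x ∂arc, p x) ↔ ∀ᵐ x, x ∈ uIcc 0 (2 * π) → p x := by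
  rw [uIcc_of_le Real.two_pi_pos.le, ← ae_restrict_iff' measurableSet_Icc,
    ← restrict_Ioc_eq_restrict_Icc]

theorem memLp_arc_of_continuous {E : Type*} [NormedAddCommGroup E] {f : ℝ → E} (hf : Continuous f)
    (p : ℝ≥0∞) : MemLp f p arc := by
  obtain ⟨C, hC⟩ := isCompact_Icc.exists_bound_of_continuousOn (s := Icc 0 (2 * π)) hf.continuousOn
  exact .of_bound hf.aestronglyMeasurable C <|
    (ae_restrict_mem measurableSet_Ioc).mono fun x hx => hC x (Ioc_subset_Icc_self hx)

variable {F : Type*} [NormedAddCommGroup F] [NormedSpace ℝ F]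

theorem absCont_of_hasDerivAt {f f' : ℝ → F} (h : ∀ x, HasDerivAt f (f' x) x)
    (hf' : Continuous f') (x y : ℝ) : AbsolutelyContinuousOnInterval f x y := by
  refine ContDiffOn.absolutelyContinuousOnInterval (ContDiff.contDiffOn ?_)
  rw [contDiff_one_iff_deriv]
  refine ⟨fun t => (h t).differentiableAt, ?_⟩
  rwa [funext fun t => (h t).deriv]

theorem hasDerivAt_of_ae_hasDerivAt [CompleteSpace F] {v g : ℝ → F} {T : ℝ} (hT : 0 < T)
    (hvp : Function.Periodic v T) (hv : AbsolutelyContinuousOnInterval v 0 T)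
    (hgp : Function.Periodic g T) (hg : Continuous g)
    (h : ∀ᵐ x, x ∈ uIcc 0 T → HasDerivAt v (g x) x) (x : ℝ) : HasDerivAt v (g x) x := by
  have hprim (x : ℝ) : HasDerivAt (fun y => ∫ t in (0 : ℝ)..y, g t) (g x) x :=
    (hg.integral_hasStrictDerivAt 0 x).hasDerivAt
  obtain ⟨c, hc⟩ := (hv.fun_sub (absCont_of_hasDerivAt hprim hg 0 T)).const_of_ae_hasDerivAt_zero
    (by filter_upwards [h] with x hx hxT
        exact ((hx hxT).sub (hprim x)).congr_deriv (sub_self _))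
  have hEqOn : EqOn v (fun x => c + ∫ t in (0 : ℝ)..x, g t) (Icc 0 T) := fun x hx =>
    sub_eq_iff_eq_add.1 (hc x (by rwa [uIcc_of_le hT.le]))
  have hintegral : ∫ t in (0 : ℝ)..T, g t = 0 := by
    have hends := (hEqOn (left_mem_Icc.2 hT.le)).symm.trans
      (hvp.eq.symm.trans (hEqOn (right_mem_Icc.2 hT.le)))
    simpa using hends
  have hprim_periodic := periodic_primitive hg hgp hintegral
  rw [eq_of_periodic_of_eqOn hT hvp (fun x => by simp only [hprim_periodic x]) hEqOn]
  exact (hprim x).const_add c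

end AbsolutelyContinuous

section FourierDerivative

variable {T : ℝ} [hT : Fact (0 < T)]

theorem exists_continuousMap_addCircle {T : ℝ} {F : Type*} [TopologicalSpace F] {u : ℝ → F}
    (hu : Continuous u) (hp : Function.Periodic u T) :
    ∃ f : C(AddCircle T, F), ∀ t : ℝ, f t = u t :=
  ⟨⟨hp.lift, continuous_coinduced_dom.2 hu⟩, fun _ => rfl⟩

theorem continuousMap_ext_fourierCoeff {f g : C(AddCircle T, ℂ)}
    (h : ∀ n, fourierCoeff f n = fourierCoeff g n) : f = g := by
  refine ContinuousMap.toLp_injective (p := 2) (𝕜 := ℂ) AddCircle.haarAddCircle ?_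
  refine fourierBasis.repr.injective (lp.ext (funext fun n => ?_))
  rw [fourierBasis_repr, fourierBasis_repr, fourierCoeff_toLp, fourierCoeff_toLp, h]

theorem fourierCoeff_of_hasDerivAt {f g : C(AddCircle T, ℂ)}
    (h : ∀ x : ℝ, HasDerivAt (fun t : ℝ => f t) (g x) x) (n : ℤ) :
    fourierCoeff g n = 2 * π * Complex.I * n / T * fourierCoeff f n := by
  have hprod (x : ℝ) : HasDerivAt (fun t : ℝ => fourier (-n) (t : AddCircle T) * f t)
      (-2 * π * Complex.I * n / T * (fourier (-n) (x : AddCircle T) * f x) +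
        fourier (-n) (x : AddCircle T) * g x) x :=
    ((hasDerivAt_fourier_neg T n x).mul (h x)).congr_deriv (by ring)
  have hparts := intervalIntegral.integral_eq_sub_of_hasDerivAt (a := 0) (b := T)
    (fun x _ => hprod x) (Continuous.intervalIntegrable (by fun_prop) _ _)
  rw [AddCircle.coe_period, AddCircle.coe_zero, sub_self, intervalIntegral.integral_add
    (Continuous.intervalIntegrable (by fun_prop) _ _)
    (Continuous.intervalIntegrable (by fun_prop) _ _),
    intervalIntegral.integral_const_mul] at hparts
  simp only [fourierCoeff_eq_intervalIntegral _ n 0, zero_add, smul_eq_mul, Complex.real_smul]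
  linear_combination ((1 / T : ℝ) : ℂ) * hparts

theorem exists_primitive_fourierCoeff_zero_eq {g : C(AddCircle T, ℂ)} (hg : fourierCoeff g 0 = 0)
    (c : ℂ) : ∃ f : C(AddCircle T, ℂ), fourierCoeff f 0 = c ∧
      ∀ x : ℝ, HasDerivAt (fun t : ℝ => f t) (g x) x := by
  have hgc : Continuous fun t : ℝ => g t := by fun_prop
  have hderiv (x : ℝ) : HasDerivAt (fun y => ∫ t in (0 : ℝ)..y, g t) (g x) x :=
    (hgc.integral_hasStrictDerivAt 0 x).hasDerivAt
  have hgp : Function.Periodic (fun t : ℝ => g t) T := fun t => by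
    simp only [AddCircle.coe_add_period]
  have hintegral : ∫ t in (0 : ℝ)..T, g t = 0 := by
    simpa [fourierCoeff_eq_intervalIntegral _ 0 0, hT.out.ne'] using hg
  obtain ⟨G, hG⟩ := exists_continuousMap_addCircle
    (continuous_of_hasDerivAt hderiv) (periodic_primitive hgc hgp hintegral)
  refine ⟨G + ContinuousMap.const _ (c - fourierCoeff G 0), ?_, fun x => ?_⟩
  · have hGi : Integrable G AddCircle.haarAddCircle := G.continuous.integrable_of_hasCompactSupport
      (HasCompactSupport.of_compactSpace _)
    have hadd := congrFun (fourierCoeff.add hGi (integrable_const (c - fourierCoeff G 0))) 0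
    simpa [fourierCoeff] using hadd
  · simpa [hG] using (hderiv x).add_const (c - fourierCoeff G 0)

theorem exists_hasDerivAt_hasDerivAt_iff {f g : C(AddCircle T, ℂ)} :
    (∃ v : ℝ → ℂ, (∀ x : ℝ, HasDerivAt (fun t : ℝ => f t) (v x) x) ∧
      ∀ x : ℝ, HasDerivAt v (g x) x) ↔
    ∀ n : ℤ, fourierCoeff g n = (2 * π * Complex.I * n / T) ^ 2 * fourierCoeff f n := by
  constructor
  · rintro ⟨v, hf, hv⟩ n
    have hfp : Function.Periodic (fun t : ℝ => f t) T := fun t => by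
      simp only [AddCircle.coe_add_period]
    obtain ⟨w, hw⟩ := exists_continuousMap_addCircle
      (continuous_of_hasDerivAt hv) (periodic_of_hasDerivAt hfp hf)
    obtain rfl : (fun t : ℝ => w t) = v := funext hw
    rw [fourierCoeff_of_hasDerivAt hv, fourierCoeff_of_hasDerivAt hf]
    ring
  · intro h
    obtain ⟨v, hv0, hv⟩ := exists_primitive_fourierCoeff_zero_eq (g := g) (by simp [h 0]) 0
    obtain ⟨w, hw0, hw⟩ := exists_primitive_fourierCoeff_zero_eq hv0 (fourierCoeff f 0)
    obtain rfl : w = f := continuousMap_ext_fourierCoeff fun n => by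
      rcases eq_or_ne n 0 with rfl | hn
      · exact hw0
      · have hne : 2 * π * Complex.I * n / T ≠ 0 := by simp [hn, hT.out.ne', Real.pi_ne_zero]
        refine mul_left_cancel₀ (pow_ne_zero 2 hne) ?_
        rw [← h n, fourierCoeff_of_hasDerivAt hv, fourierCoeff_of_hasDerivAt hw]
        ring
    exact ⟨fun t => v t, hw, hv⟩

end FourierDerivative

section MultiplicationOperator

open scoped InnerProductSpace

variable {T : ℝ} [hT : Fact (0 < T)]

/-- Multiplication by the real function `α` on the Hilbert space `L²` of the circle. -/
noncomputable def mulOperator (α : C(AddCircle T, ℝ)) :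
    Lp ℂ 2 (@AddCircle.haarAddCircle T hT) →L[ℂ] Lp ℂ 2 (@AddCircle.haarAddCircle T hT) :=
  (ContinuousLinearMap.mul ℂ ℂ).holderL AddCircle.haarAddCircle ∞ 2 2
    (ContinuousMap.toLp ∞ AddCircle.haarAddCircle ℂ ⟨fun x => (α x : ℂ), by fun_prop⟩)

theorem coeFn_mulOperator (α : C(AddCircle T, ℝ)) (x : Lp ℂ 2 (@AddCircle.haarAddCircle T hT)) :
    mulOperator α x =ᵐ[AddCircle.haarAddCircle] fun t => α t * x t := by
  filter_upwards [(ContinuousLinearMap.mul ℂ ℂ).coeFn_holder (r := 2)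
    (ContinuousMap.toLp ∞ AddCircle.haarAddCircle ℂ ⟨fun x => (α x : ℂ), by fun_prop⟩) x,
    ContinuousMap.coeFn_toLp (p := ∞) AddCircle.haarAddCircle (𝕜 := ℂ)
      (⟨fun x => (α x : ℂ), by fun_prop⟩ : C(AddCircle T, ℂ))] with t h1 h2
  refine h1.trans ?_
  rw [h2]
  rfl

theorem isSelfAdjoint_mulOperator (α : C(AddCircle T, ℝ)) : IsSelfAdjoint (mulOperator α) := by
  rw [ContinuousLinearMap.isSelfAdjoint_iff_isSymmetric]
  intro x y
  rw [L2.inner_def, L2.inner_def]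
  refine integral_congr_ae ?_
  filter_upwards [coeFn_mulOperator α x, coeFn_mulOperator α y] with t hx hy
  simp only [ContinuousLinearMap.coe_coe, hx, hy, RCLike.inner_apply, map_mul, Complex.conj_ofReal]
  ring

theorem mulOperator_toLp (α : C(AddCircle T, ℝ)) (f : C(AddCircle T, ℂ)) :
    mulOperator α (ContinuousMap.toLp 2 AddCircle.haarAddCircle ℂ f) =
      ContinuousMap.toLp 2 AddCircle.haarAddCircle ℂ ⟨fun t => α t * f t, by fun_prop⟩ := by
  refine Lp.ext ?_
  filter_upwards [coeFn_mulOperator α (ContinuousMap.toLp 2 AddCircle.haarAddCircle ℂ f),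
    ContinuousMap.coeFn_toLp (p := 2) AddCircle.haarAddCircle (𝕜 := ℂ) f,
    ContinuousMap.coeFn_toLp (p := 2) AddCircle.haarAddCircle (𝕜 := ℂ)
      (⟨fun t => α t * f t, by fun_prop⟩ : C(AddCircle T, ℂ))] with t h1 h2 h3
  rw [h1, h2, h3]
  rfl

theorem inner_fourierBasis_toLp (f : C(AddCircle T, ℂ)) (n : ℤ) :
    ⟪fourierBasis n, ContinuousMap.toLp 2 AddCircle.haarAddCircle ℂ f⟫_ℂ = fourierCoeff f n := by
  rw [← HilbertBasis.repr_apply_apply, fourierBasis_repr, fourierCoeff_toLp]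

theorem exists_toLp_eq_of_summable {x : Lp ℂ 2 (@AddCircle.haarAddCircle T hT)}
    (h : Summable fun n => fourierCoeff x n) :
    ∃ f : C(AddCircle T, ℂ), ContinuousMap.toLp 2 AddCircle.haarAddCircle ℂ f = x := by
  have hsum : Summable fun n => fourierCoeff x n • (fourier n : C(AddCircle T, ℂ)) :=
    .of_norm (by simpa only [norm_smul, fourier_norm, mul_one] using h.norm)
  refine ⟨_, (hsum.hasSum.mapL (ContinuousMap.toLp 2 AddCircle.haarAddCircle ℂ)).unique ?_⟩
  simpa only [map_smul] using hasSum_fourier_series_L2 x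

end MultiplicationOperator

section Hill

local instance factTwoPiPos : Fact (0 < 2 * π) := ⟨Real.two_pi_pos⟩

/-- The classical `2π`-periodic solutions of Hill's equation `-u'' + a u = z u`. -/
noncomputable def hillSpace (a : ℝ → ℝ) (z : ℂ) : Submodule ℂ (ℝ → ℂ) where
  carrier := {u | Function.Periodic u (2 * π) ∧ ∃ v : ℝ → ℂ,
    (∀ x, HasDerivAt u (v x) x) ∧ ∀ x, HasDerivAt v ((a x - z) * u x) x}
  zero_mem' := ⟨fun _ => rfl, 0, fun x => hasDerivAt_const x 0, fun x => by simp⟩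
  add_mem' := by
    rintro u₁ u₂ ⟨p₁, v₁, h₁, k₁⟩ ⟨p₂, v₂, h₂, k₂⟩
    exact ⟨p₁.add p₂, v₁ + v₂, fun x => (h₁ x).add (h₂ x),
      fun x => ((k₁ x).add (k₂ x)).congr_deriv (mul_add _ _ _).symm⟩
  smul_mem' := by
    rintro c u ⟨p, v, h, k⟩
    exact ⟨p.smul c, c • v, fun x => (h x).const_smul c,
      fun x => ((k x).const_smul c).congr_deriv (mul_left_comm _ _ _)⟩

theorem coe_mem_hillSpace_iff {a : ℝ → ℝ} {α : C(AddCircle (2 * π), ℝ)} (hα : ∀ t : ℝ, α t = a t)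
    {z : ℂ} {f : C(AddCircle (2 * π), ℂ)} :
    (fun t : ℝ => f t) ∈ hillSpace a z ↔ ContinuousMap.toLp 2 AddCircle.haarAddCircle ℂ f ∈
      perturbedEigenspace fourierBasis (fun k : ℤ => (k : ℝ) ^ 2) (mulOperator α) z := by
  let g : C(AddCircle (2 * π), ℂ) := ⟨fun t => α t * f t, by fun_prop⟩
  have hcoeff (n : ℤ) : fourierCoeff (g - z • f) n = fourierCoeff g n - z * fourierCoeff f n := by
    simp only [← inner_fourierBasis_toLp, map_sub, map_smul, inner_sub_right, inner_smul_right]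
  have hfactor (n : ℤ) : (2 * π * Complex.I * n / (2 * π : ℝ)) ^ 2 = -(n : ℂ) ^ 2 := by
    have hπ : (π : ℂ) ≠ 0 := by simp [Real.pi_ne_zero]
    push_cast
    field_simp
    simp
  have hperiodic : Function.Periodic (fun t : ℝ => f t) (2 * π) := fun t => by
    simp only [AddCircle.coe_add_period]
  calc (fun t : ℝ => f t) ∈ hillSpace a z
    _ ↔ ∃ v : ℝ → ℂ, (∀ x : ℝ, HasDerivAt (fun t : ℝ => f t) (v x) x) ∧
          ∀ x : ℝ, HasDerivAt v ((g - z • f) x) x := by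
      refine (and_iff_right hperiodic).trans ?_
      simp only [ContinuousMap.sub_apply, ContinuousMap.smul_apply, smul_eq_mul, sub_mul, ← hα]
      rfl
    _ ↔ ∀ n : ℤ, fourierCoeff g n - z * fourierCoeff f n = -(n : ℂ) ^ 2 * fourierCoeff f n := by
      simp only [exists_hasDerivAt_hasDerivAt_iff, hfactor, ← hcoeff]
    _ ↔ _ := by
      refine forall_congr' fun n => ?_
      rw [mulOperator_toLp, inner_fourierBasis_toLp, inner_fourierBasis_toLp, sub_eq_iff_eq_add]
      push_cast
      ring_nf
      rfl

theorem exists_toLp_eq_of_mem_perturbedEigenspace {T : ℝ} [hT : Fact (0 < T)]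
    {V : Lp ℂ 2 (@AddCircle.haarAddCircle T hT) →L[ℂ] Lp ℂ 2 (@AddCircle.haarAddCircle T hT)}
    {z : ℂ} {x : Lp ℂ 2 (@AddCircle.haarAddCircle T hT)}
    (hx : x ∈ perturbedEigenspace fourierBasis (fun k : ℤ => (k : ℝ) ^ 2) V z) :
    ∃ f : C(AddCircle T, ℂ), ContinuousMap.toLp 2 AddCircle.haarAddCircle ℂ f = x := by
  refine exists_toLp_eq_of_summable (.of_norm_bounded_eventually
    ((Real.summable_one_div_int_pow.2 one_lt_two).mul_left ‖z • x - V x‖) ?_)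
  filter_upwards [(finite_singleton 0).eventually_cofinite_notMem] with k hk
  have hk2 : 0 < (k : ℝ) ^ 2 := by positivity [show k ≠ 0 from hk]
  have hinner : inner ℂ (fourierBasis k) (z • x - V x) = (k : ℝ) ^ 2 * fourierCoeff x k := by
    rw [← fourierBasis_repr, HilbertBasis.repr_apply_apply, inner_sub_right, inner_smul_right, hx k]
    push_cast
    ring
  have hle := norm_inner_le_norm (𝕜 := ℂ) (fourierBasis k) (z • x - V x)
  rw [hinner, norm_mul, fourierBasis.orthonormal.norm_eq_one, one_mul, norm_pow, Complex.norm_real,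
    Real.norm_eq_abs, sq_abs] at hle
  rw [mul_one_div, le_div_iff₀' hk2]
  exact hle

theorem rank_hillSpace {a : ℝ → ℝ} {α : C(AddCircle (2 * π), ℝ)} (hα : ∀ t : ℝ, α t = a t)
    (z : ℂ) : Module.rank ℂ (hillSpace a z) = Module.rank ℂ
      (perturbedEigenspace fourierBasis (fun k : ℤ => (k : ℝ) ^ 2) (mulOperator α) z) := by
  let Φ : C(AddCircle (2 * π), ℂ) →ₗ[ℂ] ℝ → ℂ :=
    LinearMap.funLeft ℂ ℂ (fun t : ℝ => (t : AddCircle (2 * π))) ∘ₗ ContinuousMap.coeFnLinearMap ℂ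
  let Ψ : C(AddCircle (2 * π), ℂ) →ₗ[ℂ] Lp ℂ 2 (AddCircle.haarAddCircle (T := 2 * π)) :=
    (ContinuousMap.toLp 2 AddCircle.haarAddCircle ℂ).toLinearMap
  have hΦ : Function.Injective Φ :=
    (LinearMap.funLeft_injective_of_surjective ℂ ℂ _ QuotientAddGroup.mk_surjective).comp
      DFunLike.coe_injective
  have hΨ : Function.Injective Ψ := ContinuousMap.toLp_injective _
  set W := perturbedEigenspace fourierBasis (fun k : ℤ => (k : ℝ) ^ 2) (mulOperator α) z
  have hhill : (W.comap Ψ).map Φ = hillSpace a z := by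
    ext u
    refine ⟨?_, fun hu => ?_⟩
    · rintro ⟨f, hf, rfl⟩
      exact (coe_mem_hillSpace_iff hα).2 hf
    · obtain ⟨hp, v, huv, -⟩ := id hu
      obtain ⟨f, hf⟩ := exists_continuousMap_addCircle
        (continuous_of_hasDerivAt huv) hp
      obtain rfl : (fun t : ℝ => f t) = u := funext hf
      exact ⟨f, (coe_mem_hillSpace_iff hα).1 hu, rfl⟩
  have hW : (W.comap Ψ).map Ψ = W := by
    refine Submodule.map_comap_eq_of_le fun x hx => ?_
    obtain ⟨f, rfl⟩ := exists_toLp_eq_of_mem_perturbedEigenspace hx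
    exact ⟨f, rfl⟩
  calc Module.rank ℂ (hillSpace a z)
    _ = Module.rank ℂ (W.comap Ψ) := by
      rw [← hhill, ← (Submodule.equivMapOfInjective Φ hΦ _).rank_eq]
    _ = Module.rank ℂ W := by
      rw [(Submodule.equivMapOfInjective Ψ hΨ _).rank_eq, hW]

theorem tendsto_int_sq_cofinite : Tendsto (fun k : ℤ => (k : ℝ) ^ 2) cofinite atTop := by
  simpa only [Function.comp_def, Real.norm_eq_abs, sq_abs] using
    (tendsto_pow_atTop two_ne_zero).comp
      (tendsto_norm_cocompact_atTop.comp Int.tendsto_coe_cofinite)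

theorem monotone_sq_intEquivNat_symm :
    Monotone ((fun k : ℤ => (k : ℝ) ^ 2) ∘ Equiv.intEquivNat.symm) := by
  have hval (k : ℤ) : Equiv.intEquivNat k = if 0 ≤ k then 2 * k.natAbs else 2 * k.natAbs - 1 := by
    obtain n | n := k
    · exact (if_pos (Int.natCast_nonneg n)).symm
    · exact (if_neg (Int.negSucc_lt_zero n).not_ge).symm
  intro m n hmn
  obtain ⟨j, rfl⟩ := Equiv.intEquivNat.surjective m
  obtain ⟨k, rfl⟩ := Equiv.intEquivNat.surjective n
  simp only [Function.comp_apply, Equiv.symm_apply_apply]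
  rw [hval, hval] at hmn
  exact_mod_cast Int.natAbs_le_iff_sq_le.1 (by split_ifs at hmn <;> omega)

theorem toENat_rank_hillSpace {a : ℝ → ℝ} {α : C(AddCircle (2 * π), ℝ)}
    (hα : ∀ t : ℝ, α t = a t) (z : ℂ) :
    Cardinal.toENat (Module.rank ℂ (hillSpace a z)) = Module.finrank ℂ
      (perturbedEigenspace fourierBasis (fun k : ℤ => (k : ℝ) ^ 2) (mulOperator α) z) := by
  have := finiteDimensional_perturbedEigenspace (b := fourierBasis) tendsto_int_sq_cofinite
    (isSelfAdjoint_mulOperator α) z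
  rw [rank_hillSpace hα, ← Module.finrank_eq_rank, Cardinal.toENat_nat]

theorem exists_monotone_hill_eigenvalues {a : ℝ → ℝ} (ha : Continuous a)
    (hp : Function.Periodic a (2 * π)) :
    ∃ μ : ℕ → ℝ, Monotone μ ∧ Tendsto μ atTop atTop ∧ ∀ z : ℂ,
      {k | (μ k : ℂ) = z}.encard = Cardinal.toENat (Module.rank ℂ (hillSpace a z)) := by
  obtain ⟨α, hα⟩ := exists_continuousMap_addCircle ha hp
  obtain ⟨μ, hmono, htend, hμ⟩ := exists_monotone_eigenvalues fourierBasis tendsto_int_sq_cofinite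
    (isSelfAdjoint_mulOperator α)
  refine ⟨μ, hmono, htend, fun z => ?_⟩
  rw [toENat_rank_hillSpace hα]
  by_cases hz : starRingEnd ℂ z = z
  · obtain ⟨l, rfl⟩ := Complex.conj_eq_iff_real.1 hz
    simp only [Complex.ofReal_inj]
    exact hμ l
  · rw [perturbedEigenspace_eq_bot (isSelfAdjoint_mulOperator α) hz, finrank_bot, Nat.cast_zero,
      encard_eq_zero]
    exact eq_empty_of_forall_notMem fun k hk => hz (hk ▸ Complex.conj_ofReal _)

theorem exists_abs_hill_eigenvalue_sub_sq_le {a : ℝ → ℝ} (ha : Continuous a)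
    (hp : Function.Periodic a (2 * π)) : ∃ M : ℝ, ∀ μ : ℕ → ℝ, Monotone μ →
      (∀ z : ℂ, {k | (μ k : ℂ) = z}.encard = Cardinal.toENat (Module.rank ℂ (hillSpace a z))) →
      ∀ j : ℤ, |μ (Equiv.intEquivNat j) - (j : ℝ) ^ 2| ≤ M := by
  obtain ⟨α, hα⟩ := exists_continuousMap_addCircle ha hp
  refine ⟨‖mulOperator α‖, fun μ hmono hμ j => ?_⟩
  simpa only [Equiv.symm_apply_apply] using abs_sub_le_norm_of_monotone (b := fourierBasis)
    tendsto_int_sq_cofinite (isSelfAdjoint_mulOperator α) hmono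
    (fun l => by
      have hl := hμ l
      simp only [toENat_rank_hillSpace hα, Complex.ofReal_inj] at hl
      exact hl)
    monotone_sq_intEquivNat_symm (Equiv.intEquivNat j)

end Hill

section Oscillation

theorem exists_amplitude_phase {j : ℤ} (hj : j ≠ 0) (p q : ℝ) :
    ∃ ρ θ : ℝ, 0 ≤ ρ ∧ θ ∈ Icc 0 (2 * π) ∧
      ∀ x : ℝ, p * Real.cos (j * x) + q * Real.sin (j * x) = ρ * Real.cos (j * (x - θ)) := by
  have hj' : (j : ℝ) ≠ 0 := Int.cast_ne_zero.2 hj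
  let z : ℂ := ⟨p, q⟩
  have hp : ‖z‖ * Real.cos z.arg = p := Complex.norm_mul_cos_arg z
  have hq : ‖z‖ * Real.sin z.arg = q := Complex.norm_mul_sin_arg z
  refine ⟨‖z‖, toIcoMod Real.two_pi_pos 0 (z.arg / j), norm_nonneg _,
    Ico_subset_Icc_self (toIcoMod_mem_Ico' _ _), fun x => ?_⟩
  set k := toIcoDiv Real.two_pi_pos 0 (z.arg / j)
  have hphase : j * (x - toIcoMod Real.two_pi_pos 0 (z.arg / j)) =
      j * x - z.arg + (j * k : ℤ) * (2 * π) := by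
    rw [toIcoMod, zsmul_eq_mul]
    push_cast
    field_simp
    ring
  rw [hphase, Real.cos_add_int_mul_two_pi, Real.cos_sub, ← hp, ← hq]
  ring

theorem abs_integral_mul_cos_le {f : ℝ → ℝ} (hp : Function.Periodic f (2 * π))
    (hf : AbsolutelyContinuousOnInterval f 0 (2 * π)) {m : ℤ} (hm : m ≠ 0) (θ : ℝ) :
    |∫ t in (0 : ℝ)..(2 * π), f t * Real.cos (m * (t - θ))| ≤
      (∫ t in (0 : ℝ)..(2 * π), |deriv f t|) / |(m : ℝ)| := by
  have hm' : (m : ℝ) ≠ 0 := Int.cast_ne_zero.2 hm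
  let g : ℝ → ℝ := fun t => Real.sin (m * (t - θ)) / m
  have hg (t : ℝ) : HasDerivAt g (Real.cos (m * (t - θ))) t := by
    refine ((((hasDerivAt_id t).sub_const θ).const_mul (m : ℝ)).sin.div_const _).congr_deriv ?_
    rw [mul_one, mul_div_cancel_right₀ _ hm', id]
  have hgac : AbsolutelyContinuousOnInterval g 0 (2 * π) :=
    ContDiffOn.absolutelyContinuousOnInterval (ContDiff.contDiffOn (by fun_prop))
  have hgp : g (2 * π) = g 0 := by
    simp only [g]
    rw [show (m : ℝ) * (2 * π - θ) = m * (0 - θ) + m * (2 * π) by ring,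
      Real.sin_add_int_mul_two_pi]
  have hparts := hf.integral_mul_deriv_eq_deriv_mul hgac
  rw [funext fun t => (hg t).deriv, hgp, hp.eq, sub_self, zero_sub] at hparts
  rw [hparts, abs_neg, ← mul_one_div, ← intervalIntegral.integral_mul_const]
  refine intervalIntegral.abs_integral_le_integral_abs Real.two_pi_pos.le |>.trans ?_
  have hi := hf.intervalIntegrable_deriv
  refine intervalIntegral.integral_mono_on Real.two_pi_pos.le
    (hi.mul_continuousOn hgac.continuousOn).abs (hi.abs.mul_const _) fun t _ => ?_
  rw [abs_mul, abs_div]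
  gcongr
  exact Real.abs_sin_le_one _

theorem integral_mul_cos_sq {f : ℝ → ℝ} {c d : ℝ} (hf : IntervalIntegrable f volume c d)
    (ω θ : ℝ) : ∫ t in c..d, f t * Real.cos (ω * (t - θ)) ^ 2 =
      ((∫ t in c..d, f t) + ∫ t in c..d, f t * Real.cos (2 * ω * (t - θ))) / 2 := by
  rw [← intervalIntegral.integral_add hf
    (hf.mul_continuousOn (Continuous.continuousOn (by fun_prop))), ← intervalIntegral.integral_div]
  refine intervalIntegral.integral_congr fun t _ => ?_
  simp only [Real.cos_sq, ← mul_assoc]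
  ring

theorem integral_cos_sq_sub {j : ℤ} (hj : j ≠ 0) (θ : ℝ) :
    ∫ t in (0 : ℝ)..(2 * π), Real.cos (j * (t - θ)) ^ 2 = π := by
  have hsq := integral_mul_cos_sq (intervalIntegrable_const (μ := volume) (c := (1 : ℝ))
    (a := 0) (b := 2 * π)) j θ
  have hosc := abs_integral_mul_cos_le (f := fun _ => 1) (fun _ => rfl)
    (ContDiffOn.absolutelyContinuousOnInterval contDiffOn_const) (mul_ne_zero two_ne_zero hj) θ
  simp only [deriv_const, abs_zero, intervalIntegral.integral_zero, zero_div, abs_nonpos_iff,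
    one_mul, Int.cast_mul, Int.cast_ofNat] at hosc
  simp only [one_mul, hosc, intervalIntegral.integral_const, sub_zero, smul_eq_mul, mul_one,
    add_zero] at hsq
  rw [hsq, mul_div_cancel_left₀ _ two_ne_zero]

theorem abs_sqrt_integral_sq_sub_le {Ω : Type*} [MeasurableSpace Ω] {μ : Measure Ω}
    [IsFiniteMeasure μ] {f g : Ω → ℝ} (hf : MemLp f 2 μ) (hg : MemLp g 2 μ) {ε : ℝ} (hε : 0 ≤ ε)
    (h : ∀ᵐ x ∂μ, |f x - g x| ≤ ε) :
    |√(∫ x, f x ^ 2 ∂μ) - √(∫ x, g x ^ 2 ∂μ)| ≤ √(μ.real univ) * ε := by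
  have hnorm {k : Ω → ℝ} (hk : MemLp k 2 μ) : ‖hk.toLp k‖ = √(∫ x, k x ^ 2 ∂μ) := by
    rw [norm_eq_sqrt_real_inner, L2.inner_def]
    congr 1
    refine integral_congr_ae ?_
    filter_upwards [hk.coeFn_toLp] with x hx
    rw [hx, real_inner_self_eq_norm_sq, Real.norm_eq_abs, sq_abs]
  rw [← hnorm hf, ← hnorm hg]
  refine (abs_norm_sub_norm_le _ _).trans ?_
  rw [← MemLp.toLp_sub]
  have hle := Lp.norm_le_of_ae_bound (f := (hf.sub hg).toLp (f - g)) hε (by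
    filter_upwards [(hf.sub hg).coeFn_toLp, h] with x hx hxε
    rw [hx]
    exact hxε)
  refine hle.trans_eq ?_
  rw [Real.sqrt_eq_rpow, one_div, ENNReal.toReal_ofNat]
  rfl

end Oscillation

section HillAsymptotics

theorem integral_mul_cos_sub_eq {u v f : ℝ → ℝ} {ω : ℝ} (hf : Continuous f)
    (hu : ∀ x, HasDerivAt u (v x) x) (hv : ∀ x, HasDerivAt v (f x - ω ^ 2 * u x) x)
    (φ c d : ℝ) : ∫ t in c..d, f t * Real.cos (ω * t - φ) =
      (v d * Real.cos (ω * d - φ) + ω * u d * Real.sin (ω * d - φ)) -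
      (v c * Real.cos (ω * c - φ) + ω * u c * Real.sin (ω * c - φ)) := by
  refine intervalIntegral.integral_eq_sub_of_hasDerivAt
    (f := fun t => v t * Real.cos (ω * t - φ) + ω * u t * Real.sin (ω * t - φ)) (fun t _ => ?_)
    (Continuous.intervalIntegrable (by fun_prop) _ _)
  have harg : HasDerivAt (fun t => ω * t - φ) ω t := by
    simpa using ((hasDerivAt_id t).const_mul ω).sub_const φ
  refine (((hv t).mul harg.cos).add (((hu t).const_mul ω).mul harg.sin)).congr_deriv ?_
  ring

theorem variation_of_constants {u v f : ℝ → ℝ} {ω : ℝ} (hω : ω ≠ 0) (hf : Continuous f)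
    (hu : ∀ x, HasDerivAt u (v x) x) (hv : ∀ x, HasDerivAt v (f x - ω ^ 2 * u x) x) (x : ℝ) :
    u x = u 0 * Real.cos (ω * x) + v 0 / ω * Real.sin (ω * x) +
      (∫ t in (0 : ℝ)..x, f t * Real.sin (ω * (x - t))) / ω := by
  have hsin (t : ℝ) : Real.cos (ω * t - (ω * x + π / 2)) = -Real.sin (ω * (x - t)) := by
    rw [← sub_sub, Real.cos_sub_pi_div_two, ← Real.sin_neg]
    congr 1
    ring
  have hcos (t : ℝ) : Real.sin (ω * t - (ω * x + π / 2)) = -Real.cos (ω * (x - t)) := by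
    rw [← sub_sub, Real.sin_sub_pi_div_two, ← Real.cos_neg (ω * (x - t))]
    congr 2
    ring
  have h := integral_mul_cos_sub_eq hf hu hv (ω * x + π / 2) 0 x
  simp only [hsin, hcos] at h
  simp only [mul_neg, intervalIntegral.integral_neg, sub_self, sub_zero, mul_zero, Real.sin_zero,
    Real.cos_zero] at h
  field_simp
  linear_combination h

theorem exists_abs_sub_mul_cos_le {u v f : ℝ → ℝ} {j : ℤ} (hj : j ≠ 0) (hf : Continuous f)
    (hp : Function.Periodic u (2 * π)) (hu : ∀ x, HasDerivAt u (v x) x)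
    (hv : ∀ x, HasDerivAt v (f x - (j : ℝ) ^ 2 * u x) x) :
    ∃ ρ θ : ℝ, 0 ≤ ρ ∧ θ ∈ Icc 0 (2 * π) ∧ ∀ x, |u x - ρ * Real.cos (j * (x - θ))| ≤
      (∫ t in (0 : ℝ)..(2 * π), |f t|) / |(j : ℝ)| := by
  have hj' : (j : ℝ) ≠ 0 := Int.cast_ne_zero.2 hj
  obtain ⟨ρ, θ, hρ, hθ, hwave⟩ := exists_amplitude_phase hj (u 0) (v 0 / j)
  refine ⟨ρ, θ, hρ, hθ, fun x => ?_⟩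
  have hper : Function.Periodic (fun t => u t - ρ * Real.cos (j * (t - θ))) (2 * π) := fun t => by
    simp only [hp t]
    rw [show (j : ℝ) * (t + 2 * π - θ) = j * (t - θ) + j * (2 * π) by ring,
      Real.cos_add_int_mul_two_pi]
  obtain ⟨y, hy, hxy⟩ := hper.exists_mem_Ico₀ Real.two_pi_pos x
  rw [hxy, variation_of_constants hj' hf hu hv y, hwave, add_sub_cancel_left, abs_div]
  gcongr
  calc |∫ t in (0 : ℝ)..y, f t * Real.sin (j * (y - t))|
    _ ≤ ∫ t in (0 : ℝ)..y, |f t * Real.sin (j * (y - t))| :=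
      intervalIntegral.abs_integral_le_integral_abs hy.1
    _ ≤ ∫ t in (0 : ℝ)..y, |f t| := by
      refine intervalIntegral.integral_mono_on hy.1
        (Continuous.intervalIntegrable (by fun_prop) _ _) (hf.abs.intervalIntegrable _ _)
        fun t _ => ?_
      rw [abs_mul]
      exact mul_le_of_le_one_right (abs_nonneg _) (Real.abs_sin_le_one _)
    _ ≤ ∫ t in (0 : ℝ)..(2 * π), |f t| :=
      intervalIntegral.integral_mono_interval le_rfl hy.1 hy.2.le
        (Eventually.of_forall fun t => abs_nonneg _) (hf.abs.intervalIntegrable _ _)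

theorem integral_mul_cos_eq_zero {u v f : ℝ → ℝ} {j : ℤ} (hf : Continuous f)
    (hp : Function.Periodic u (2 * π)) (hu : ∀ x, HasDerivAt u (v x) x)
    (hv : ∀ x, HasDerivAt v (f x - (j : ℝ) ^ 2 * u x) x) (θ : ℝ) :
    ∫ t in (0 : ℝ)..(2 * π), f t * Real.cos (j * (t - θ)) = 0 := by
  have hend : (j : ℝ) * (2 * π) - j * θ = j * 0 - j * θ + j * (2 * π) := by ring
  simp only [mul_sub]
  rw [integral_mul_cos_sub_eq hf hu hv, hend, Real.cos_add_int_mul_two_pi,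
    Real.sin_add_int_mul_two_pi, hp.eq, (periodic_of_hasDerivAt hp hu).eq, sub_self]

theorem integral_abs_le_of_integral_sq {u : ℝ → ℝ} (hu : Continuous u)
    (hnorm : ∫ t in (0 : ℝ)..(2 * π), u t ^ 2 = 1) : ∫ t in (0 : ℝ)..(2 * π), |u t| ≤ 4 := by
  calc ∫ t in (0 : ℝ)..(2 * π), |u t|
    _ ≤ ∫ t in (0 : ℝ)..(2 * π), (1 + u t ^ 2) / 2 := by
      refine intervalIntegral.integral_mono_on Real.two_pi_pos.le
        (hu.abs.intervalIntegrable _ _) (Continuous.intervalIntegrable (by fun_prop) _ _)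
        fun t _ => ?_
      nlinarith [sq_nonneg (|u t| - 1), sq_abs (u t)]
    _ = (2 * π + 1) / 2 := by
      rw [intervalIntegral.integral_div, intervalIntegral.integral_add intervalIntegrable_const
        (Continuous.intervalIntegrable (by fun_prop) _ _), hnorm, intervalIntegral.integral_const,
        sub_zero, smul_eq_mul, mul_one]
    _ ≤ 4 := by linarith [Real.pi_lt_d2]

theorem abs_sub_one_div_sqrt_pi_le {u : ℝ → ℝ} (hu : Continuous u)
    (hnorm : ∫ t in (0 : ℝ)..(2 * π), u t ^ 2 = 1) {j : ℤ} (hj : j ≠ 0) {ρ θ ε : ℝ} (hρ : 0 ≤ ρ)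
    (h : ∀ x, |u x - ρ * Real.cos (j * (x - θ))| ≤ ε) : |ρ - 1 / √π| ≤ 2 * ε := by
  have hε : 0 ≤ ε := (abs_nonneg _).trans (h 0)
  have hsqrt : 0 < √π := Real.sqrt_pos.2 Real.pi_pos
  have hwave : ∫ t in (0 : ℝ)..(2 * π), (ρ * Real.cos (j * (t - θ))) ^ 2 = (ρ * √π) ^ 2 := by
    simp only [mul_pow]
    rw [intervalIntegral.integral_const_mul, integral_cos_sq_sub hj, Real.sq_sqrt Real.pi_pos.le]
  have hL2 := abs_sqrt_integral_sq_sub_le (memLp_arc_of_continuous hu 2)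
    (memLp_arc_of_continuous (f := fun t => ρ * Real.cos (j * (t - θ))) (by fun_prop) 2) hε
    (ae_of_all _ h)
  rw [← intervalIntegral.integral_of_le Real.two_pi_pos.le,
    ← intervalIntegral.integral_of_le Real.two_pi_pos.le, hnorm, hwave, Real.sqrt_one,
    Real.sqrt_sq (by positivity)] at hL2
  have hlen : √(arc.real univ) ≤ 2 * √π := by
    rw [measureReal_restrict_apply_univ, Real.volume_real_Ioc_of_le Real.two_pi_pos.le,
      Real.sqrt_le_iff, mul_pow, Real.sq_sqrt Real.pi_pos.le]
    exact ⟨by positivity, by linarith [Real.pi_pos]⟩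
  have hfactor : |1 - ρ * √π| = |ρ - 1 / √π| * √π := by
    rw [← abs_of_pos hsqrt, ← abs_mul, abs_of_pos hsqrt, abs_sub_comm]
    congr 1
    field_simp
  rw [hfactor] at hL2
  refine le_of_mul_le_mul_right (hL2.trans ?_) hsqrt
  calc √(arc.real univ) * ε
    _ ≤ 2 * √π * ε := by gcongr
    _ = 2 * ε * √π := by ring

variable {q u v : ℝ → ℝ} {j : ℤ} {M : ℝ}

theorem exists_abs_sub_cos_le (hq : Continuous q) (hM : ∀ x, |q x| ≤ M) (hj : j ≠ 0)
    (hp : Function.Periodic u (2 * π)) (hu : ∀ x, HasDerivAt u (v x) x)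
    (hv : ∀ x, HasDerivAt v (q x * u x - (j : ℝ) ^ 2 * u x) x)
    (hnorm : ∫ t in (0 : ℝ)..(2 * π), u t ^ 2 = 1) :
    ∃ θ ∈ Icc 0 (2 * π), ∀ x,
      |u x - 1 / √π * Real.cos (j * (x - θ))| ≤ 12 * M / |(j : ℝ)| := by
  have hM0 : 0 ≤ M := (abs_nonneg _).trans (hM 0)
  have huc : Continuous u := continuous_of_hasDerivAt hu
  obtain ⟨ρ, θ, hρ, hθ, hwave⟩ := exists_abs_sub_mul_cos_le hj (hq.mul huc) hp hu hv
  have hforcing : ∫ t in (0 : ℝ)..(2 * π), |q t * u t| ≤ 4 * M := by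
    calc ∫ t in (0 : ℝ)..(2 * π), |q t * u t|
      _ ≤ ∫ t in (0 : ℝ)..(2 * π), M * |u t| := by
        refine intervalIntegral.integral_mono_on Real.two_pi_pos.le
          ((hq.mul huc).abs.intervalIntegrable _ _)
          (Continuous.intervalIntegrable (by fun_prop) _ _) fun t _ => ?_
        rw [abs_mul]
        gcongr
        exact hM t
      _ ≤ 4 * M := by
        rw [intervalIntegral.integral_const_mul, mul_comm 4 M]
        gcongr
        exact integral_abs_le_of_integral_sq huc hnorm
  have hwave' (x : ℝ) : |u x - ρ * Real.cos (j * (x - θ))| ≤ 4 * M / |(j : ℝ)| :=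
    (hwave x).trans (by gcongr; exact hforcing)
  have hρ' := abs_sub_one_div_sqrt_pi_le huc hnorm hj hρ hwave'
  refine ⟨θ, hθ, fun x => ?_⟩
  calc |u x - 1 / √π * Real.cos (j * (x - θ))|
    _ = |(u x - ρ * Real.cos (j * (x - θ))) + (ρ - 1 / √π) * Real.cos (j * (x - θ))| := by ring_nf
    _ ≤ |u x - ρ * Real.cos (j * (x - θ))| + |ρ - 1 / √π| * |Real.cos (j * (x - θ))| :=
      (abs_add_le _ _).trans_eq (by rw [abs_mul])
    _ ≤ 4 * M / |(j : ℝ)| + 2 * (4 * M / |(j : ℝ)|) * 1 := by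
      gcongr
      exacts [hwave' x, Real.abs_cos_le_one _]
    _ = 12 * M / |(j : ℝ)| := by ring

theorem mean_eq_of_hasDerivAt (hq : Continuous q)
    (hp : Function.Periodic u (2 * π)) (hu : ∀ x, HasDerivAt u (v x) x)
    (hv : ∀ x, HasDerivAt v (q x * u x - (j : ℝ) ^ 2 * u x) x) (θ : ℝ) :
    mean q = -((∫ t in (0 : ℝ)..(2 * π), q t * Real.cos ((2 * j : ℤ) * (t - θ))) / (2 * π)) -
      (∫ t in (0 : ℝ)..(2 * π),
        q t * (u t - 1 / √π * Real.cos (j * (t - θ))) * Real.cos (j * (t - θ))) / √π := by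
  have huc : Continuous u := continuous_of_hasDerivAt hu
  have horth := integral_mul_cos_eq_zero (f := fun t => q t * u t) (by fun_prop) hp hu hv θ
  have hsplit : ∫ t in (0 : ℝ)..(2 * π), q t * u t * Real.cos (j * (t - θ)) =
      1 / √π * (∫ t in (0 : ℝ)..(2 * π), q t * Real.cos (j * (t - θ)) ^ 2) +
        ∫ t in (0 : ℝ)..(2 * π),
          q t * (u t - 1 / √π * Real.cos (j * (t - θ))) * Real.cos (j * (t - θ)) := by
    rw [← intervalIntegral.integral_const_mul, ← intervalIntegral.integral_add
      (Continuous.intervalIntegrable (by fun_prop) _ _)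
      (Continuous.intervalIntegrable (by fun_prop) _ _)]
    exact intervalIntegral.integral_congr fun t _ => by ring
  rw [horth, integral_mul_cos_sq (hq.intervalIntegrable _ _)] at hsplit
  have hinv : 1 / √π * (1 / √π) = 1 / π := by
    rw [one_div_mul_one_div, Real.mul_self_sqrt Real.pi_pos.le]
  push_cast
  rw [mean]
  set P := ∫ t in (0 : ℝ)..(2 * π), q t * Real.cos (2 * j * (t - θ))
  set S := ∫ t in (0 : ℝ)..(2 * π), q t
  linear_combination (-1 / √π) * hsplit - (S + P) / 2 * hinv

theorem abs_mean_le (hqp : Function.Periodic q (2 * π))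
    (hqac : AbsolutelyContinuousOnInterval q 0 (2 * π)) (hq : Continuous q)
    (hM : ∀ x, |q x| ≤ M) (hj : j ≠ 0)
    (hp : Function.Periodic u (2 * π)) (hu : ∀ x, HasDerivAt u (v x) x)
    (hv : ∀ x, HasDerivAt v (q x * u x - (j : ℝ) ^ 2 * u x) x) {θ ε : ℝ}
    (h : ∀ x, |u x - 1 / √π * Real.cos (j * (x - θ))| ≤ ε) :
    |mean q| ≤ (∫ t in (0 : ℝ)..(2 * π), |deriv q t|) / |(j : ℝ)| + 4 * M * ε := by
  have hsqrt : 0 < √π := Real.sqrt_pos.2 Real.pi_pos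
  have hsq : √π ^ 2 = π := Real.sq_sqrt Real.pi_pos.le
  have hsqrt_le : √π ≤ 2 := Real.sqrt_le_iff.2 ⟨zero_le_two, by linarith [Real.pi_le_four]⟩
  have hj' : 0 < |(j : ℝ)| := abs_pos.2 (Int.cast_ne_zero.2 hj)
  have hMε : 0 ≤ M * ε :=
    mul_nonneg ((abs_nonneg _).trans (hM 0)) ((abs_nonneg _).trans (h 0))
  have hosc := abs_integral_mul_cos_le hqp hqac (mul_ne_zero two_ne_zero hj) θ
  have hrem : |∫ t in (0 : ℝ)..(2 * π), q t * (u t - 1 / √π * Real.cos (j * (t - θ))) *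
      Real.cos (j * (t - θ))| ≤ M * ε * (2 * π) := by
    rw [← Real.norm_eq_abs]
    refine (intervalIntegral.norm_integral_le_of_norm_le_const (C := M * ε) fun t _ => ?_).trans_eq
      (by rw [sub_zero, abs_of_pos Real.two_pi_pos])
    rw [Real.norm_eq_abs, abs_mul, abs_mul]
    exact (mul_le_of_le_one_right (by positivity) (Real.abs_cos_le_one _)).trans
      (mul_le_mul (hM t) (h t) (abs_nonneg _) ((abs_nonneg _).trans (hM t)))
  rw [mean_eq_of_hasDerivAt hq hp hu hv θ]
  set J := ∫ t in (0 : ℝ)..(2 * π), |deriv q t|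
  have hJ : 0 ≤ J := intervalIntegral.integral_nonneg Real.two_pi_pos.le fun _ _ => abs_nonneg _
  have hfreq : |(j : ℝ)| ≤ |((2 * j : ℤ) : ℝ)| * (2 * π) := by
    push_cast
    rw [abs_mul, abs_two]
    nlinarith [Real.pi_gt_three]
  refine (abs_sub _ _).trans (add_le_add ?_ ?_)
  · rw [abs_neg, abs_div, abs_of_pos Real.two_pi_pos]
    refine (div_le_div_of_nonneg_right hosc Real.two_pi_pos.le).trans ?_
    rw [div_div]
    gcongr
  · rw [abs_div, abs_of_pos hsqrt, div_le_iff₀ hsqrt]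
    calc _ ≤ M * ε * (2 * π) := hrem
      _ = M * ε * (2 * √π) * √π := by linear_combination (-2 * (M * ε)) * hsq
      _ ≤ M * ε * (2 * 2) * √π := by gcongr
      _ = 4 * M * ε * √π := by ring

theorem ofReal_mem_hillSpace_iff {a u : ℝ → ℝ} {l : ℝ} :
    (fun t => (u t : ℂ)) ∈ hillSpace a l ↔ Function.Periodic u (2 * π) ∧ ∃ v : ℝ → ℝ,
      (∀ x, HasDerivAt u (v x) x) ∧ ∀ x, HasDerivAt v ((a x - l) * u x) x := by
  refine and_congr ?_ ⟨?_, ?_⟩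
  · simp only [Function.Periodic, Complex.ofReal_inj]
  · rintro ⟨v, huv, hv⟩
    refine ⟨fun x => (v x).re, fun x => ?_, fun x => ?_⟩
    · exact Complex.reCLM.hasFDerivAt.comp_hasDerivAt x (huv x)
    · refine (Complex.reCLM.hasFDerivAt.comp_hasDerivAt x (hv x)).congr_deriv ?_
      rw [Complex.reCLM_apply, ← Complex.ofReal_sub, ← Complex.ofReal_mul, Complex.ofReal_re]
  · rintro ⟨v, huv, hv⟩
    exact ⟨fun x => v x, fun x => (huv x).ofReal_comp,
      fun x => (hv x).ofReal_comp.congr_deriv (by push_cast; rfl)⟩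

theorem conj_mem_hillSpace {a : ℝ → ℝ} {z : ℂ} {u : ℝ → ℂ} (hu : u ∈ hillSpace a z) :
    (fun t => starRingEnd ℂ (u t)) ∈ hillSpace a (starRingEnd ℂ z) := by
  obtain ⟨hp, v, huv, hv⟩ := hu
  refine ⟨fun t => by simp only [hp t], fun t => starRingEnd ℂ (v t), fun x => (huv x).star,
    fun x => (hv x).star.congr_deriv ?_⟩
  simp

theorem exists_ofReal_mem_hillSpace {a : ℝ → ℝ} {l : ℝ} (h : hillSpace a l ≠ ⊥) :
    ∃ u : ℝ → ℝ, (fun t => (u t : ℂ)) ∈ hillSpace a l ∧ u ≠ 0 := by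
  obtain ⟨f, hf, hf0⟩ := Submodule.exists_mem_ne_zero_of_ne_bot h
  obtain ⟨x, hx⟩ := Function.ne_iff.1 hf0
  have hconj := conj_mem_hillSpace hf
  rw [Complex.conj_ofReal] at hconj
  refine ⟨fun t => 2 * (starRingEnd ℂ (f x) * f t).re, ?_, fun h0 => hx ?_⟩
  · convert! add_mem (Submodule.smul_mem _ (starRingEnd ℂ (f x)) hf)
      (Submodule.smul_mem _ (f x) hconj) using 1
    funext t
    simp only [Pi.add_apply, Pi.smul_apply, smul_eq_mul]
    rw [← Complex.add_conj, map_mul, Complex.conj_conj]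
  · have hx0 := congrFun h0 x
    simpa [← Complex.normSq_eq_conj_mul_self] using hx0

theorem exists_normalized_mem_hillSpace {a : ℝ → ℝ} {l : ℝ} (h : hillSpace a l ≠ ⊥) :
    ∃ u : ℝ → ℝ, (fun t => (u t : ℂ)) ∈ hillSpace a l ∧
      ∫ t in (0 : ℝ)..(2 * π), u t ^ 2 = 1 := by
  obtain ⟨u, hu, hu0⟩ := exists_ofReal_mem_hillSpace h
  obtain ⟨hp, v, huv, -⟩ := ofReal_mem_hillSpace_iff.1 hu
  have huc : Continuous u := continuous_of_hasDerivAt huv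
  obtain ⟨x, hx⟩ := Function.ne_iff.1 hu0
  obtain ⟨y, hy, hxy⟩ := hp.exists_mem_Ico₀ Real.two_pi_pos x
  have hpos : 0 < ∫ t in (0 : ℝ)..(2 * π), u t ^ 2 :=
    intervalIntegral.integral_pos Real.two_pi_pos (by fun_prop) (fun _ _ => sq_nonneg _)
      ⟨y, Ico_subset_Icc_self hy, by rw [← hxy]; exact sq_pos_of_ne_zero hx⟩
  set I := ∫ t in (0 : ℝ)..(2 * π), u t ^ 2
  refine ⟨fun t => (√I)⁻¹ * u t, ?_, ?_⟩
  · simp only [Complex.ofReal_mul]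
    exact Submodule.smul_mem _ (((√I)⁻¹ : ℝ) : ℂ) hu
  · simp only [mul_pow]
    rw [intervalIntegral.integral_const_mul, inv_pow, Real.sq_sqrt hpos.le,
      inv_mul_cancel₀ hpos.ne']

theorem mean_sub_const {f : ℝ → ℝ} (hf : Continuous f) (c : ℝ) :
    mean (fun t => f t - c) = mean f - c := by
  simp only [mean]
  rw [intervalIntegral.integral_sub (hf.intervalIntegrable _ _) intervalIntegrable_const,
    intervalIntegral.integral_const, smul_eq_mul, sub_zero]
  field_simp

theorem hill_asymptotics_of_abs_sub_le {a : ℝ → ℝ} (ha : Continuous a)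
    (hap : Function.Periodic a (2 * π)) (hac : AbsolutelyContinuousOnInterval a 0 (2 * π))
    (hj : j ≠ 0) {l : ℝ} (hM : ∀ x, |a x - (l - (j : ℝ) ^ 2)| ≤ M) (h : hillSpace a l ≠ ⊥) :
    |l - (mean a + (j : ℝ) ^ 2)| ≤
        ((∫ t in (0 : ℝ)..(2 * π), |deriv a t|) + 48 * M ^ 2) / |(j : ℝ)| ∧
      ∃ θ ∈ Icc 0 (2 * π), ∃ u : ℝ → ℝ, (fun t => (u t : ℂ)) ∈ hillSpace a l ∧
        ∫ t in (0 : ℝ)..(2 * π), u t ^ 2 = 1 ∧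
        ∀ t, |u t - 1 / √π * Real.cos (j * (t - θ))| ≤ 12 * M / |(j : ℝ)| := by
  obtain ⟨u, hu, hnorm⟩ := exists_normalized_mem_hillSpace h
  obtain ⟨hup, v, huv, hv⟩ := ofReal_mem_hillSpace_iff.1 hu
  have hv' (x : ℝ) :
      HasDerivAt v ((a x - (l - (j : ℝ) ^ 2)) * u x - (j : ℝ) ^ 2 * u x) x :=
    (hv x).congr_deriv (by ring)
  have hc : Continuous fun x => a x - (l - (j : ℝ) ^ 2) := by fun_prop
  obtain ⟨θ, hθ, hwave⟩ := exists_abs_sub_cos_le hc hM hj hup huv hv' hnorm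
  refine ⟨?_, θ, hθ, u, hu, hnorm, hwave⟩
  have hmean := abs_mean_le (q := fun x => a x - (l - (j : ℝ) ^ 2))
    (fun x => by simp only [hap x])
    (hac.fun_sub (ContDiffOn.absolutelyContinuousOnInterval contDiffOn_const)) hc hM hj hup huv
    hv' hwave
  simp only [mean_sub_const ha, deriv_sub_const] at hmean
  calc |l - (mean a + (j : ℝ) ^ 2)|
    _ = |mean a - (l - (j : ℝ) ^ 2)| := by
      rw [abs_sub_comm]
      ring_nf
    _ ≤ _ := hmean
    _ = _ := by ring

theorem hill_asymptotics {a : ℝ → ℝ} (ha : Continuous a) (hap : Function.Periodic a (2 * π))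
    (hac : AbsolutelyContinuousOnInterval a 0 (2 * π)) (B : ℝ) :
    ∃ K : ℝ, ∀ j : ℤ, j ≠ 0 → ∀ l : ℝ, |l - (j : ℝ) ^ 2| ≤ B → hillSpace a l ≠ ⊥ →
      |l - (mean a + (j : ℝ) ^ 2)| ≤ K / |(j : ℝ)| ∧
      ∃ θ ∈ Icc 0 (2 * π), ∃ u : ℝ → ℝ, (fun t => (u t : ℂ)) ∈ hillSpace a l ∧
        ∫ t in (0 : ℝ)..(2 * π), u t ^ 2 = 1 ∧
        ∀ t, |u t - 1 / √π * Real.cos (j * (t - θ))| ≤ K / |(j : ℝ)| := by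
  obtain ⟨α, hα⟩ := (hap.isBounded_of_continuous Real.two_pi_pos.ne' ha).exists_norm_le
  refine ⟨max ((∫ t in (0 : ℝ)..(2 * π), |deriv a t|) + 48 * (α + B) ^ 2) (12 * (α + B)),
    fun j hj l hl h => ?_⟩
  obtain ⟨hlj, θ, hθ, u, hu, hnorm, hwave⟩ := hill_asymptotics_of_abs_sub_le ha hap hac hj
    (fun x => (abs_sub _ _).trans (add_le_add (hα _ (mem_range_self x)) hl)) h
  exact ⟨hlj.trans (by gcongr; exact le_max_left _ _), θ, hθ, u, hu, hnorm,
    fun t => (hwave t).trans (by gcongr; exact le_max_right _ _)⟩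

end HillAsymptotics

section Gauge

/-- The phase `θ ↦ exp (s i ∫₀^θ A)`: multiplication by `gauge A 1` conjugates `(-i d/dθ + A)²`
to `-d²/dθ²`. -/
noncomputable def gauge (A : ℝ → ℝ) (s : ℂ) (t : ℝ) : ℂ :=
  Complex.exp (s * Complex.I * ((∫ x in (0 : ℝ)..t, A x : ℝ) : ℂ))

theorem gauge_neg_mul (A : ℝ → ℝ) (s : ℂ) : gauge A (-s) * gauge A s = 1 := by
  funext t
  rw [Pi.mul_apply, gauge, gauge, ← Complex.exp_add, neg_mul, neg_mul, neg_add_cancel,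
    Complex.exp_zero, Pi.one_apply]

theorem norm_gauge_ofReal (A : ℝ → ℝ) (s t : ℝ) : ‖gauge A s t‖ = 1 := by
  rw [gauge, mul_right_comm, ← Complex.ofReal_mul, Complex.norm_exp_ofReal_mul_I]

variable {A : ℝ → ℝ} {s : ℂ} {z : ℂ}

theorem periodic_gauge (hA : Continuous A) (hp : Function.Periodic A (2 * π)) {n : ℤ}
    (hn : mean A = n) (s : ℤ) : Function.Periodic (gauge A s) (2 * π) := fun t => by
  have hintegral : ∫ x in (0 : ℝ)..(2 * π), A x = n * (2 * π) := by
    rw [← hn, mean]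
    field_simp
  have hadd := hp.intervalIntegral_add_eq_add 0 t fun _ _ => hA.intervalIntegrable _ _
  rw [zero_add, hintegral] at hadd
  rw [gauge, gauge, hadd, Complex.exp_eq_exp_iff_exists_int]
  exact ⟨s * n, by push_cast; ring⟩

theorem hasDerivAt_gauge (hA : Continuous A) (t : ℝ) :
    HasDerivAt (gauge A s) (s * Complex.I * A t * gauge A s t) t := by
  have hprim := (hA.integral_hasStrictDerivAt 0 t).hasDerivAt
  exact (hprim.ofReal_comp.const_mul (s * Complex.I)).cexp.congr_deriv (mul_comm _ _)

theorem continuous_gauge (hA : Continuous A) : Continuous (gauge A s) :=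
  continuous_of_hasDerivAt (hasDerivAt_gauge hA)

theorem hasDerivAt_gauge_mul (hA : Continuous A) {φ : ℝ → ℂ} {φ' : ℂ} {x : ℝ}
    (hφ : HasDerivAt φ φ' x) :
    HasDerivAt (gauge A s * φ) (gauge A s x * (φ' + s * Complex.I * A x * φ x)) x :=
  ((hasDerivAt_gauge hA x).mul hφ).congr_deriv (by ring)

theorem hasDerivAt_gauge_mul_magnetic (hA : Continuous A) {φ ψ : ℝ → ℂ} {A' : ℝ} {ψ' : ℂ} {x : ℝ}
    (hA' : HasDerivAt A A' x) (hφ : HasDerivAt φ (ψ x) x) (hψ : HasDerivAt ψ ψ' x) :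
    HasDerivAt (fun y => gauge A s y * (ψ y + s * Complex.I * A y * φ y))
      (gauge A s x * (ψ' + 2 * (s * Complex.I * A x) * ψ x
        + (s * Complex.I * A' + (s * Complex.I * A x) ^ 2) * φ x)) x :=
  (hasDerivAt_gauge_mul hA
    (hψ.add ((hA'.ofReal_comp.const_mul (s * Complex.I)).mul hφ))).congr_deriv
    (by simp only [Pi.add_apply, Pi.mul_apply]; ring)

theorem absCont_gauge_mul_magnetic (hA : Continuous A)
    (hAac : AbsolutelyContinuousOnInterval A 0 (2 * π)) {φ ψ : ℝ → ℂ}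
    (hφ : ∀ x, HasDerivAt φ (ψ x) x) (hψ : Continuous ψ)
    (hψac : AbsolutelyContinuousOnInterval ψ 0 (2 * π)) :
    AbsolutelyContinuousOnInterval (fun y => gauge A s y * (ψ y + s * Complex.I * A y * φ y))
      0 (2 * π) := by
  have hgauge := continuous_gauge (s := s) hA
  have hgauge_ac := absCont_of_hasDerivAt (hasDerivAt_gauge (s := s) hA) (by fun_prop) 0 (2 * π)
  convert! hgauge_ac.fun_smul (hψac.fun_add
    ((hAac.fun_smul (absCont_of_hasDerivAt hφ hψ _ _)).const_smul (s * Complex.I))) using 3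
  simp only [Complex.real_smul, smul_eq_mul]
  ring

variable {a : ℝ → ℝ} {n : ℤ} {φ u : ℝ → ℂ}

theorem gauge_mul_mem_hillSpace {p : ℝ≥0∞} (ha : Continuous a)
    (hap : Function.Periodic a (2 * π)) (hA : MemW1 p A) (hn : mean A = n)
    (hφ : φ ∈ eigenspace A a z) : gauge A 1 * φ ∈ hillSpace a z := by
  obtain ⟨hφ, heq⟩ := hφ
  have hAc := hA.continuous
  have hφ' (x : ℝ) : HasDerivAt φ (deriv φ x) x := (hφ.differentiable x).hasDerivAt
  have hgauge := continuous_gauge (s := 1) hAc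
  have hgauge_periodic : Function.Periodic (gauge A 1) (2 * π) := by
    simpa only [Int.cast_one] using periodic_gauge hAc hA.periodic hn 1
  have hφc := hφ.differentiable.continuous
  refine ⟨hgauge_periodic.mul hφ.periodic, _, fun x => hasDerivAt_gauge_mul hAc (hφ' x),
    hasDerivAt_of_ae_hasDerivAt Real.two_pi_pos (fun x => ?_)
      (absCont_gauge_mul_magnetic hAc hA.absCont hφ' hφ.deriv_mem.continuous hφ.deriv_mem.absCont)
      (fun x => ?_) (by fun_prop) ?_⟩
  · simp only [hgauge_periodic x, hφ.deriv_mem.periodic x, hA.periodic x, hφ.periodic x]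
  · simp only [Pi.mul_apply, hap x, hgauge_periodic x, hφ.periodic x]
  · filter_upwards [hA.absCont.ae_differentiableAt, ae_arc_iff.1 heq,
      ae_arc_iff.1 hφ.deriv_mem.ae_differentiableAt] with x hAx heqx hφx hx
    refine (hasDerivAt_gauge_mul_magnetic hAc (hAx hx).hasDerivAt (hφ' x)
      (hφx hx).hasDerivAt).congr_deriv ?_
    have heigen := heqx hx
    rw [magneticOp] at heigen
    rw [Pi.mul_apply]
    linear_combination -gauge A 1 x * heigen + gauge A 1 x * A x ^ 2 * φ x * Complex.I_sq

theorem deriv_gauge_mul (hA : Continuous A) {v : ℝ → ℂ} (hu : ∀ x, HasDerivAt u (v x) x) :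
    deriv (gauge A s * u) = fun x => gauge A s x * (v x + s * Complex.I * A x * u x) :=
  funext fun x => (hasDerivAt_gauge_mul hA (hu x)).deriv

theorem deriv_deriv_gauge_mul {p : ℝ≥0∞} (hA : MemW1 p A) {v w : ℝ → ℂ}
    (hu : ∀ x, HasDerivAt u (v x) x) (hv : ∀ x, HasDerivAt v (w x) x) :
    deriv (deriv (gauge A s * u)) =ᵐ[arc] fun x =>
      gauge A s x * (w x + 2 * (s * Complex.I * A x) * v x
        + (s * Complex.I * deriv A x + (s * Complex.I * A x) ^ 2) * u x) := by
  rw [deriv_gauge_mul hA.continuous hu]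
  filter_upwards [ae_arc_iff.2 hA.absCont.ae_differentiableAt] with x hAx
  exact (hasDerivAt_gauge_mul_magnetic hA.continuous hAx.hasDerivAt (hu x) (hv x)).deriv

theorem memLp_deriv_deriv_gauge_mul {p : ℝ≥0∞} (hA : MemW1 p A) {v w : ℝ → ℂ}
    (hu : ∀ x, HasDerivAt u (v x) x) (hv : ∀ x, HasDerivAt v (w x) x) (hw : Continuous w) :
    MemLp (deriv (deriv (gauge A s * u))) p arc := by
  have hAc := hA.continuous
  have hgauge := continuous_gauge (s := s) hAc
  have huc : Continuous u := continuous_of_hasDerivAt hu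
  have hvc : Continuous v := continuous_of_hasDerivAt hv
  have hcont : MemLp (fun x => gauge A s x * (w x + 2 * (s * Complex.I * A x) * v x
      + (s * Complex.I * A x) ^ 2 * u x)) p arc := memLp_arc_of_continuous (by fun_prop) p
  have hpot : MemLp (fun x => ((deriv A x : ℝ) : ℂ) * (s * Complex.I * gauge A s x * u x)) p arc :=
    (memLp_arc_of_continuous (f := fun x => s * Complex.I * gauge A s x * u x)
      (by fun_prop) ⊤).mul' hA.memLp_deriv.ofReal
  refine (hcont.add hpot).ae_eq ?_
  filter_upwards [deriv_deriv_gauge_mul (s := s) hA hu hv] with x hx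
  rw [hx, Pi.add_apply]
  ring

theorem gauge_mul_mem_eigenspace (ha : Continuous a) (hA : MemW1 2 A) (hn : mean A = n)
    (hu : u ∈ hillSpace a z) : gauge A (-1) * u ∈ eigenspace A a z := by
  obtain ⟨hup, v, huv, hv⟩ := hu
  have hAc := hA.continuous
  have hgauge := continuous_gauge (s := -1) hAc
  have hgauge_periodic : Function.Periodic (gauge A (-1)) (2 * π) := by
    simpa only [Int.cast_neg, Int.cast_one] using periodic_gauge hAc hA.periodic hn (-1)
  have huc : Continuous u := continuous_of_hasDerivAt huv
  have hvc : Continuous v := continuous_of_hasDerivAt hv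
  have hv_periodic := periodic_of_hasDerivAt hup huv
  have hderiv := deriv_gauge_mul (s := -1) hAc huv
  refine ⟨⟨hgauge_periodic.mul hup, ?_, ?_, ?_, ?_⟩, ?_⟩
  · rw [contDiff_one_iff_deriv, hderiv]
    exact ⟨fun x => (hasDerivAt_gauge_mul hAc (huv x)).differentiableAt, by fun_prop⟩
  · rw [hderiv]
    exact fun x => by simp only [hgauge_periodic x, hv_periodic x, hA.periodic x, hup x]
  · rw [hderiv]
    exact absCont_gauge_mul_magnetic hAc hA.absCont huv hvc
      (absCont_of_hasDerivAt hv (by fun_prop) _ _)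
  · exact memLp_deriv_deriv_gauge_mul hA huv hv (by fun_prop)
  · filter_upwards [deriv_deriv_gauge_mul (s := -1) hA huv hv] with x hx
    rw [magneticOp, hx, hderiv, Pi.mul_apply]
    linear_combination gauge A (-1) x * A x ^ 2 * u x * Complex.I_sq

theorem rank_eigenspace (ha : Continuous a) (hap : Function.Periodic a (2 * π))
    (hA : MemW1 2 A) (hn : mean A = n) (z : ℂ) :
    Module.rank ℂ (eigenspace A a z) = Module.rank ℂ (hillSpace a z) := by
  have hleft := gauge_neg_mul A 1
  have hright : gauge A 1 * gauge A (-1) = 1 := by rw [mul_comm, hleft]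
  exact LinearEquiv.rank_eq
    { toFun := fun φ => ⟨gauge A 1 * φ.1, gauge_mul_mem_hillSpace ha hap hA hn φ.2⟩
      invFun := fun u => ⟨gauge A (-1) * u.1, gauge_mul_mem_eigenspace ha hA hn u.2⟩
      map_add' := fun φ ψ => Subtype.ext (mul_add _ _ _)
      map_smul' := fun c φ => Subtype.ext (mul_smul_comm _ _ _)
      left_inv := fun φ => Subtype.ext (by simp only [← mul_assoc, hleft, one_mul])
      right_inv := fun u => Subtype.ext (by simp only [← mul_assoc, hright, one_mul]) }

end Gauge

section MagneticAsymptotics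

variable {a A : ℝ → ℝ} {n : ℤ}

theorem exists_isEigenvalueSeq (ha : Continuous a) (hap : Function.Periodic a (2 * π))
    (hA : MemW1 2 A) (hn : mean A = n) :
    ∃ μ : ℕ → ℝ, IsEigenvalueSeq A a μ ∧ Tendsto μ atTop atTop := by
  obtain ⟨μ, hmono, htendsto, hmult⟩ := exists_monotone_hill_eigenvalues ha hap
  exact ⟨μ, ⟨hmono, fun z => by rw [hmult, rank_eigenspace ha hap hA hn]⟩, htendsto⟩

theorem IsEigenvalueSeq.eigenspace_ne_bot {μ : ℕ → ℝ} (hμ : IsEigenvalueSeq A a μ) (k : ℕ) :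
    eigenspace A a (μ k) ≠ ⊥ := fun h => by
  have hempty := hμ.mult (μ k)
  rw [h, rank_bot, map_zero, encard_eq_zero] at hempty
  exact notMem_empty k (hempty.subset rfl)

theorem hillSpace_ne_bot (ha : Continuous a) (hap : Function.Periodic a (2 * π))
    (hA : MemW1 2 A) (hn : mean A = n) {z : ℂ} (h : eigenspace A a z ≠ ⊥) :
    hillSpace a z ≠ ⊥ := by
  rwa [ne_eq, ← Submodule.rank_eq_zero, ← rank_eigenspace ha hap hA hn, Submodule.rank_eq_zero]

theorem IsEigenvalueSeq.exists_asymptotics {p : ℝ≥0∞} (ha : MemW1 p a) (hA : MemW1 2 A)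
    (hn : mean A = n) {μ : ℕ → ℝ} (hμ : IsEigenvalueSeq A a μ) :
    ∃ K : ℝ, ∀ j : ℤ, j ≠ 0 →
      |μ (Equiv.intEquivNat j) - (mean a + (j : ℝ) ^ 2)| ≤ K / |(j : ℝ)| ∧
      ∃ θ ∈ Icc 0 (2 * π), ∃ φ ∈ eigenspace A a (μ (Equiv.intEquivNat j)),
        ∫ t in (0 : ℝ)..(2 * π), ‖φ t‖ ^ 2 = 1 ∧
        ∀ t, ‖φ t - ((1 / √π : ℝ) : ℂ) *
          Complex.exp (-Complex.I * ((∫ s in (0 : ℝ)..t, A s : ℝ) : ℂ)) *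
            (Real.cos (j * (t - θ)) : ℂ)‖ ≤ K / |(j : ℝ)| := by
  have hac := ha.continuous
  obtain ⟨B, hB⟩ := exists_abs_hill_eigenvalue_sub_sq_le hac ha.periodic
  obtain ⟨K, hK⟩ := hill_asymptotics hac ha.periodic ha.absCont B
  have hnear := hB μ hμ.mono fun z => by rw [hμ.mult, rank_eigenspace hac ha.periodic hA hn]
  refine ⟨K, fun j hj => ?_⟩
  obtain ⟨hl, θ, hθ, u, hu, hnorm, hwave⟩ := hK j hj _ (hnear j)
    (hillSpace_ne_bot hac ha.periodic hA hn (hμ.eigenspace_ne_bot _))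
  have hphase (t : ℝ) : ‖gauge A (-1) t‖ = 1 := by
    simpa only [Complex.ofReal_neg, Complex.ofReal_one] using norm_gauge_ofReal A (-1) t
  refine ⟨hl, θ, hθ, _, gauge_mul_mem_eigenspace hac hA hn hu, ?_, fun t => ?_⟩
  · simpa only [Pi.mul_apply, norm_mul, hphase, one_mul, Complex.norm_real, Real.norm_eq_abs,
      sq_abs] using hnorm
  · rw [← neg_one_mul Complex.I, ← gauge, Pi.mul_apply, mul_right_comm,
      mul_comm _ (gauge A (-1) t), ← mul_sub, norm_mul, hphase, one_mul, ← Complex.ofReal_mul,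
      ← Complex.ofReal_sub, Complex.norm_real, Real.norm_eq_abs]
    exact hwave t

theorem bijOn_intEquivNat : BijOn Equiv.intEquivNat {j : ℤ | 1 ≤ |j|} {k : ℕ | 1 ≤ k} :=
  Equiv.bijOn _ fun _ => Nat.one_le_iff_ne_zero.trans <|
    (Equiv.intEquivNat.injective.ne_iff' rfl).trans <| abs_pos.symm.trans Order.one_le_iff_pos.symm

end MagneticAsymptotics

end MagneticCircle

theorem lemmaB4_general (a A : ℝ → ℝ)
    (ha : MagneticCircle.MemW1 1 a) (hA : MagneticCircle.MemW1 2 A)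
    (hAint : ∃ n : ℤ, MagneticCircle.mean A = (n : ℝ)) :
    (∃ μ : ℕ → ℝ, MagneticCircle.IsEigenvalueSeq A a μ ∧ Tendsto μ atTop atTop) ∧
    ∀ μ : ℕ → ℝ, MagneticCircle.IsEigenvalueSeq A a μ →
      ∃ (kstar ℓ : ℕ) (lam : ℤ → ℝ),
        (∃ σ : ℤ → ℕ, BijOn σ {j : ℤ | (ℓ : ℤ) ≤ |j|} {k : ℕ | kstar ≤ k} ∧
          ∀ j : ℤ, (ℓ : ℤ) ≤ |j| → lam j = μ (σ j)) ∧
        ((fun j : ℤ => lam j - (MagneticCircle.mean a + (j : ℝ) ^ 2))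
          =O[cofinite] fun j : ℤ => 1 / |(j : ℝ)|) ∧
        ∃ (θ : ℤ → ℝ) (φ R : ℤ → ℝ → ℂ),
          (∀ j : ℤ, (ℓ : ℤ) ≤ |j| →
            θ j ∈ Icc 0 (2 * π) ∧
            φ j ∈ MagneticCircle.eigenspace A a (lam j : ℂ) ∧
            (∫ t in (0 : ℝ)..(2 * π), ‖φ j t‖ ^ 2) = 1 ∧
            ∀ t : ℝ, φ j t =
              ((1 / √π : ℝ) : ℂ) * Complex.exp (-Complex.I * ((∫ s in (0 : ℝ)..t, A s : ℝ) : ℂ)) *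
                (Real.cos ((j : ℝ) * (t - θ j)) : ℂ) + R j t) ∧
          ∃ C : ℝ, ∀ᶠ j : ℤ in cofinite, ∀ t : ℝ, ‖R j t‖ ≤ C / |(j : ℝ)| := by
  obtain ⟨n, hn⟩ := hAint
  refine ⟨MagneticCircle.exists_isEigenvalueSeq ha.continuous ha.periodic hA hn, fun μ hμ => ?_⟩
  obtain ⟨K, hK⟩ := hμ.exists_asymptotics ha hA hn
  choose! hlam θ hθ φ hφ hnorm hR using hK
  have hne (j : ℤ) (hj : (1 : ℕ) ≤ |j|) : j ≠ 0 := abs_pos.1 hj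
  have hcofinite : ∀ᶠ j : ℤ in cofinite, j ≠ 0 := (finite_singleton 0).eventually_cofinite_notMem
  refine ⟨1, 1, fun j => μ (Equiv.intEquivNat j),
    ⟨_, MagneticCircle.bijOn_intEquivNat, fun _ _ => rfl⟩, .of_bound K ?_, θ, φ, _,
    fun j hj => ⟨hθ j (hne j hj), hφ j (hne j hj), hnorm j (hne j hj),
      fun t => (add_sub_cancel _ _).symm⟩, K, hcofinite.mono hR⟩
  filter_upwards [hcofinite] with j hj
  rw [Real.norm_eq_abs, norm_div, norm_one, Real.norm_eq_abs, abs_abs, mul_one_div]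
  exact hlam j hj

theorem lemmaB4 (a A : ℝ → ℝ)
    (ha : MagneticCircle.MemW1 ⊤ a) (hA : MagneticCircle.MemW1 ⊤ A)
    (hAint : ∃ n : ℤ, MagneticCircle.mean A = (n : ℝ)) :
    (∃ μ : ℕ → ℝ, MagneticCircle.IsEigenvalueSeq A a μ ∧ Tendsto μ atTop atTop) ∧
    ∀ μ : ℕ → ℝ, MagneticCircle.IsEigenvalueSeq A a μ →
      ∃ (kstar ℓ : ℕ) (lam : ℤ → ℝ),
        (∃ σ : ℤ → ℕ, BijOn σ {j : ℤ | (ℓ : ℤ) ≤ |j|} {k : ℕ | kstar ≤ k} ∧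
          ∀ j : ℤ, (ℓ : ℤ) ≤ |j| → lam j = μ (σ j)) ∧
        ((fun j : ℤ => lam j - (MagneticCircle.mean a + (j : ℝ) ^ 2))
          =O[cofinite] fun j : ℤ => 1 / |(j : ℝ)|) ∧
        ∃ (θ : ℤ → ℝ) (φ R : ℤ → ℝ → ℂ),
          (∀ j : ℤ, (ℓ : ℤ) ≤ |j| →
            θ j ∈ Icc 0 (2 * π) ∧
            φ j ∈ MagneticCircle.eigenspace A a (lam j : ℂ) ∧
            (∫ t in (0 : ℝ)..(2 * π), ‖φ j t‖ ^ 2) = 1 ∧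
            ∀ t : ℝ, φ j t =
              ((1 / √π : ℝ) : ℂ) * Complex.exp (-Complex.I * ((∫ s in (0 : ℝ)..t, A s : ℝ) : ℂ)) *
                (Real.cos ((j : ℝ) * (t - θ j)) : ℂ) + R j t) ∧
          ∃ C : ℝ, ∀ᶠ j : ℤ in cofinite, ∀ t : ℝ, ‖R j t‖ ≤ C / |(j : ℝ)| :=
  lemmaB4_general a A (ha.mono le_top) (hA.mono le_top) hAint
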